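/- **Setting.** Let $k\ge 1$ and $d\ge 0$ be integers and let $D$ be either the interval $[0,1]$ or the unit circle $\mathbb S^1$. * $C_0^k(\mathbb R^d,\mathbb R^d)$ is the Banach space of $C^k$ vector fields which vanish at infinity together with all their derivatives of order $\le k$, normed by $\max_{i\le k}\sup_x\|D^iu(x)\|$, and $\operatorname{Diff}_{C_0^k}(\mathbb R^d)=(\mathrm{id}+C_0^k(\mathbb R^d,\mathbb R^d))\cap\operatorname{Diff}^1(\mathbb R^d)$; via $\varphi\mapsto\varphi-\mathrm{id}$ it is an open subset of $C_0^k(\mathbb R^d,\mathbb R^d)$, hence a Banach manifold, and it is a group under composition. * $\operatorname{Isom}(\mathbb R^d)=SO_d\ltimes\mathbb R^d$ is the Lie group of rigid motions, with $(R',T')(R,T)=(R'R,R'T+T')$. It acts on $\operatorname{Diff}_{C_0^k}(\mathbb R^d)$ from the right by $\rho_{(R,T)}(\varphi)(x)=R^\top\varphi(Rx+T)-R^\top T$. * $\mathcal G^k=\operatorname{Isom}(\mathbb R^d)\ltimes\operatorname{Diff}_{C_0^k}(\mathbb R^d)$ is the semidirect product with the law $(g,\varphi)(g',\varphi')=(gg',\rho_{g'}(\varphi)\circ\varphi')$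 and the product manifold structure; $e$ is its identity, and $T_e\mathcal G^{k}=\operatorname{Skew}_d\oplus\mathbb R^d\oplus C_0^{k}(\mathbb R^d,\mathbb R^d)$. * $\operatorname{Imm}_{C^k}(D,\mathbb R^d)=\{q\in C^k(D,\mathbb R^d): q'(t)\ne0\ \text{for all } t\in D\}$, an open subset of the Banach space $C^k(D,\mathbb R^d)$. $\operatorname{Isom}(\mathbb R^d)$ acts on it by $(R,T)\cdot q=Rq+T$ and $\operatorname{Diff}_{C_0^k}(\mathbb R^d)$ acts on it by $\varphi\cdot q=\varphi\circ q$. **Proposition.** 1. The action $\operatorname{Isom}(\mathbb R^d)\times\operatorname{Imm}_{C^k}(D,\mathbb R^d)\to\operatorname{Imm}_{C^k}(D,\mathbb R^d)$ is $C^\infty$, and each $(R,T)$ acts by a $C^\infty$ diffeomorphism of $\operatorname{Imm}_{C^k}(D,\mathbb R^d)$. 2. For all $\varphi\in\operatorname{Diff}_{C_0^k}(\mathbb R^d)$, $(R,T)\in\operatorname{Isom}(\mathbb R^d)$ and $q\in\operatorname{Imm}_{C^k}(D,\mathbb R^d)$, $$\varphi\cdot((R,T)\cdot q)=(R,T)\cdot(\rho_{(R,T)}(\varphi)\cdot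 q).$$ 3. Consequently, $\operatorname{Isom}(\mathbb R^d)\times\operatorname{Imm}_{C^k}(D,\mathbb R^d)$ is a shape space for the action $A$ of $\mathcal G^k$ given by $A((g,\varphi),(h,q))=(g,\varphi)\cdot(h,q)=(gh,\,g\cdot(\varphi\cdot q))$. That is, writing $\tilde{\mathcal Q}=\operatorname{Isom}(\mathbb R^d)\times\operatorname{Imm}_{C^k}(D,\mathbb R^d)$: * $A:\mathcal G^k\times\tilde{\mathcal Q}\to\tilde{\mathcal Q}$ is continuous; * for every $\tilde q\in\tilde{\mathcal Q}$ the map $\mathcal G^k\to\tilde{\mathcal Q}$, $a\mapsto a\cdot\tilde q$, is $C^\infty$; its differential at $e$ is denoted $\xi_{\tilde q}:T_e\mathcal G^k\to T_{\tilde q}\tilde{\mathcal Q}$ (the infinitesimal action); * for every integer $l>0$, the maps $\mathcal G^{k+l}\times\tilde{\mathcal Q}\to\tilde{\mathcal Q}$, $(a,\tilde q)\mapsto a\cdot\tilde q$, and $T_e\mathcal G^{k+l}\times\tilde{\mathcal Q}\to T\tilde{\mathcal Q}$, $(X,\tilde q)\mapsto\xi_{\tilde q}(X)$, are $C^l$.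 -/

import Mathlib

open Filter Topology Set
open scoped Manifold ContDiff Matrix Matrix.Norms.L2Operator

noncomputable section

/-- Euclidean space `ℝ^d`. -/
abbrev Euc (d : ℕ) : Type := EuclideanSpace ℝ (Fin d)

/-- Square real matrices, with the operator norm. -/
abbrev Mat (d : ℕ) : Type := Matrix (Fin d) (Fin d) ℝ

/-! ## The Lie group `SO_d` -/

/-- The special orthogonal group `SO_d`, with the topology induced by the space of matrices. -/
abbrev SO (d : ℕ) : Type := Matrix.specialOrthogonalGroup (Fin d) ℝ

namespace SO

variable {d : ℕ}

theorem transpose_mul_self (R : SO d) : R.1ᵀ * R.1 = 1 :=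
  (Matrix.mem_orthogonalGroup_iff' (Fin d) ℝ).1 R.2.1

theorem mul_transpose_self (R : SO d) : R.1 * R.1ᵀ = 1 :=
  (Matrix.mem_orthogonalGroup_iff (Fin d) ℝ).1 R.2.1

theorem det_eq_one (R : SO d) : R.1.det = 1 :=
  (Matrix.mem_specialOrthogonalGroup_iff.1 R.2).2

theorem coe_inv (R : SO d) : (R⁻¹).1 = R.1ᵀ := rfl

theorem coe_mul (R S : SO d) : (R * S).1 = R.1 * S.1 := rfl

theorem coe_one : (1 : SO d).1 = 1 := rfl

end SO

/-- The space `Skew_d` of skew-symmetric matrices. -/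
def Skew (d : ℕ) : Submodule ℝ (Mat d) where
  carrier := {A | Aᵀ = -A}
  add_mem' := by
    intro A B hA hB
    simp only [mem_ofPred_eq] at hA hB ⊢
    rw [Matrix.transpose_add, hA, hB]; abel
  zero_mem' := by simp
  smul_mem' := by
    intro c A hA
    simp only [mem_ofPred_eq] at hA ⊢
    rw [Matrix.transpose_smul, hA, smul_neg]

namespace Skew

variable {d : ℕ}

theorem isUnit_one_sub {B : Mat d} (hB : Bᵀ = -B) : IsUnit (1 - B) := by
  rw [← Matrix.mulVec_injective_iff_isUnit]
  refine (injective_iff_map_eq_zero (Matrix.mulVecLin (1 - B))).2 fun v hv => ?_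
  rw [Matrix.mulVecLin_apply, Matrix.sub_mulVec, Matrix.one_mulVec, sub_eq_zero] at hv
  have h1 : v ⬝ᵥ (B *ᵥ v) = -(v ⬝ᵥ (B *ᵥ v)) := by
    conv_lhs => rw [Matrix.dotProduct_mulVec, ← Matrix.mulVec_transpose, hB, Matrix.neg_mulVec,
      neg_dotProduct, dotProduct_comm]
  have h2 : v ⬝ᵥ v = 0 := by
    have : v ⬝ᵥ v = v ⬝ᵥ (B *ᵥ v) := by rw [← hv]
    linarith
  exact dotProduct_self_eq_zero.1 h2

theorem isUnit_one_add {B : Mat d} (hB : Bᵀ = -B) : IsUnit (1 + B) := by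
  have := isUnit_one_sub (B := -B) (by rw [Matrix.transpose_neg, hB])
  rwa [sub_neg_eq_add] at this

/-- Orthogonal projection of a matrix onto its skew-symmetric part. -/
def proj (d : ℕ) : Mat d →L[ℝ] Skew d :=
  LinearMap.toContinuousLinearMap
    { toFun := fun A => ⟨(1 / 2 : ℝ) • (A - Aᵀ), by
        change ((1 / 2 : ℝ) • (A - Aᵀ))ᵀ = -((1 / 2 : ℝ) • (A - Aᵀ))
        rw [Matrix.transpose_smul, Matrix.transpose_sub, Matrix.transpose_transpose, ← smul_neg,
          neg_sub]⟩
      map_add' := by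
        intro A B
        ext1
        change (1 / 2 : ℝ) • (A + B - (A + B)ᵀ) = (1 / 2 : ℝ) • (A - Aᵀ) + (1 / 2 : ℝ) • (B - Bᵀ)
        rw [← smul_add, Matrix.transpose_add]
        congr 1
        abel
      map_smul' := by
        intro c A
        ext1
        change (1 / 2 : ℝ) • (c • A - (c • A)ᵀ) = c • ((1 / 2 : ℝ) • (A - Aᵀ))
        rw [Matrix.transpose_smul, ← smul_sub, smul_comm] }

theorem proj_coe (A : Skew d) : proj d A.1 = A := by
  ext1
  change (1 / 2 : ℝ) • (A.1 - A.1ᵀ) = A.1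
  rw [show A.1ᵀ = -A.1 from A.2, sub_neg_eq_add, ← two_smul ℝ A.1, smul_smul]
  norm_num

theorem coe_proj {A : Mat d} (hA : Aᵀ = -A) : (proj d A).1 = A :=
  congrArg Subtype.val (proj_coe ⟨A, hA⟩)

end Skew

namespace SO

variable {d : ℕ}

/-- The Cayley transform `A ↦ (1 + A/2) (1 - A/2)⁻¹` on matrices; its derivative at `0` is the
identity. -/
def cayleyMat (A : Mat d) : Mat d := (1 + (1 / 2 : ℝ) • A) * (1 - (1 / 2 : ℝ) • A)⁻¹

theorem half_skew (A : Skew d) : ((1 / 2 : ℝ) • A.1)ᵀ = -((1 / 2 : ℝ) • A.1) :=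
  ((1 / 2 : ℝ) • A).2

/-- The Cayley transform sends skew-symmetric matrices to rotations. -/
def cayley (A : Skew d) : SO d := ⟨cayleyMat A.1, by
  have hB := half_skew A
  rw [cayleyMat]
  generalize (1 / 2 : ℝ) • A.1 = B at hB
  have h1 := (Matrix.isUnit_iff_isUnit_det _).1 (Skew.isUnit_one_sub hB)
  have h2 := (Matrix.isUnit_iff_isUnit_det _).1 (Skew.isUnit_one_add hB)
  have hdet : (1 + B).det = (1 - B).det := by
    rw [← Matrix.det_transpose, Matrix.transpose_add, Matrix.transpose_one, hB, sub_eq_add_neg]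
  have hc : (1 + B) * (1 - B) = (1 - B) * (1 + B) := by noncomm_ring
  refine Matrix.mem_specialOrthogonalGroup_iff.2 ⟨?_, ?_⟩
  · rw [Matrix.mem_orthogonalGroup_iff, Matrix.transpose_mul, Matrix.transpose_nonsing_inv,
      Matrix.transpose_sub, Matrix.transpose_add, Matrix.transpose_one, hB, sub_neg_eq_add,
      ← sub_eq_add_neg]
    have h3 : (1 - B)⁻¹ * (1 + B)⁻¹ = (1 + B)⁻¹ * (1 - B)⁻¹ := by
      rw [← Matrix.mul_inv_rev, ← Matrix.mul_inv_rev, hc]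
    calc (1 + B) * (1 - B)⁻¹ * ((1 + B)⁻¹ * (1 - B))
        = (1 + B) * ((1 - B)⁻¹ * (1 + B)⁻¹) * (1 - B) := by noncomm_ring
      _ = ((1 + B) * (1 + B)⁻¹) * ((1 - B)⁻¹ * (1 - B)) := by rw [h3]; noncomm_ring
      _ = 1 := by rw [Matrix.mul_nonsing_inv _ h2, Matrix.nonsing_inv_mul _ h1, one_mul]
  · rw [Matrix.det_mul, Matrix.det_nonsing_inv, hdet, Ring.mul_inverse_cancel _ h1]⟩

/-- The inverse Cayley transform `U ↦ 2 (U - 1) (U + 1)⁻¹`. -/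
def cayleyInvMat (U : Mat d) : Mat d := (2 : ℝ) • ((U - 1) * (U + 1)⁻¹)

theorem cayleyInvMat_skew {U : Mat d} (hU : Uᵀ * U = 1) (h : IsUnit (U + 1)) :
    (cayleyInvMat U)ᵀ = -cayleyInvMat U := by
  have h1 := (Matrix.isUnit_iff_isUnit_det _).1 h
  have h2 : IsUnit (Uᵀ + 1).det := by
    rw [← Matrix.det_transpose]; simpa using h1
  rw [cayleyInvMat, Matrix.transpose_smul, ← smul_neg, Matrix.transpose_mul,
    Matrix.transpose_nonsing_inv, Matrix.transpose_sub, Matrix.transpose_add, Matrix.transpose_one]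
  congr 1
  have key : (Uᵀ - 1) * (U + 1) = -((Uᵀ + 1) * (U - 1)) := by
    simp only [sub_mul, mul_add, add_mul, mul_sub, hU, mul_one, one_mul]; abel
  calc (Uᵀ + 1)⁻¹ * (Uᵀ - 1)
      = (Uᵀ + 1)⁻¹ * (Uᵀ - 1) * ((U + 1) * (U + 1)⁻¹) := by
        rw [Matrix.mul_nonsing_inv _ h1, mul_one]
    _ = (Uᵀ + 1)⁻¹ * ((Uᵀ - 1) * (U + 1)) * (U + 1)⁻¹ := by noncomm_ring
    _ = -(((Uᵀ + 1)⁻¹ * (Uᵀ + 1)) * ((U - 1) * (U + 1)⁻¹)) := by rw [key]; noncomm_ring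
    _ = _ := by rw [Matrix.nonsing_inv_mul _ h2, one_mul]

theorem cayleyMat_cayleyInvMat {U : Mat d} (hU : Uᵀ * U = 1) (h : IsUnit (U + 1)) :
    cayleyMat (cayleyInvMat U) = U := by
  have hs := cayleyInvMat_skew hU h
  have h1 := (Matrix.isUnit_iff_isUnit_det _).1 h
  have hs' : ((1 / 2 : ℝ) • cayleyInvMat U)ᵀ = -((1 / 2 : ℝ) • cayleyInvMat U) := by
    rw [Matrix.transpose_smul, hs, smul_neg]
  rw [cayleyMat]
  have hB : (1 / 2 : ℝ) • cayleyInvMat U = (U - 1) * (U + 1)⁻¹ := by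
    rw [cayleyInvMat, smul_smul]; norm_num
  rw [hB] at hs' ⊢
  have h2 := (Matrix.isUnit_iff_isUnit_det _).1 (Skew.isUnit_one_sub hs')
  have key : 1 + (U - 1) * (U + 1)⁻¹ = U * (1 - (U - 1) * (U + 1)⁻¹) := by
    have e : (1 : Mat d) = (U + 1) * (U + 1)⁻¹ := (Matrix.mul_nonsing_inv _ h1).symm
    generalize (U + 1)⁻¹ = V at e
    have e' : V = 1 - U * V := by rw [eq_sub_iff_add_eq, add_comm]; rw [add_mul, one_mul] at e; exact e.symm
    have e2 : 1 + (U - 1) * V = (2 : ℝ) • (U * V) := by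
      rw [two_smul]; nth_rewrite 1 [e]; noncomm_ring
    have e3 : 1 - (U - 1) * V = (2 : ℝ) • V := by
      rw [two_smul]; nth_rewrite 1 [e]; noncomm_ring
    rw [e2, e3, Matrix.mul_smul]
  rw [key, mul_assoc, Matrix.mul_nonsing_inv _ h2, mul_one]

theorem cayleyMat_add_one (A : Skew d) :
    cayleyMat A.1 + 1 = (2 : ℝ) • (1 - (1 / 2 : ℝ) • A.1)⁻¹ := by
  have hB := half_skew A
  rw [cayleyMat]
  generalize (1 / 2 : ℝ) • A.1 = B at hB
  have h1 := (Matrix.isUnit_iff_isUnit_det _).1 (Skew.isUnit_one_sub hB)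
  have e : (1 : Mat d) = (1 - B) * (1 - B)⁻¹ := (Matrix.mul_nonsing_inv _ h1).symm
  calc (1 + B) * (1 - B)⁻¹ + 1 = (1 + B) * (1 - B)⁻¹ + (1 - B) * (1 - B)⁻¹ := by rw [← e]
    _ = _ := by rw [two_smul]; noncomm_ring

theorem isUnit_cayleyMat_add_one (A : Skew d) : IsUnit (cayleyMat A.1 + 1) := by
  rw [cayleyMat_add_one]
  have h1 := Skew.isUnit_one_sub (half_skew A)
  have h2 : IsUnit (1 - (1 / 2 : ℝ) • A.1)⁻¹ := Matrix.isUnit_nonsing_inv_iff.2 h1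
  exact h2.smul (Units.mk0 (2 : ℝ) two_ne_zero)

theorem cayleyInvMat_cayleyMat (A : Skew d) : cayleyInvMat (cayleyMat A.1) = A.1 := by
  have hu := (Matrix.isUnit_iff_isUnit_det _).1 (isUnit_cayleyMat_add_one A)
  have hB := half_skew A
  have h1 := (Matrix.isUnit_iff_isUnit_det _).1 (Skew.isUnit_one_sub hB)
  have key : cayleyMat A.1 - 1 = ((1 / 2 : ℝ) • A.1) * (cayleyMat A.1 + 1) := by
    rw [cayleyMat_add_one, cayleyMat]
    generalize (1 / 2 : ℝ) • A.1 = B at hB h1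
    have e : (1 : Mat d) = (1 - B) * (1 - B)⁻¹ := (Matrix.mul_nonsing_inv _ h1).symm
    calc (1 + B) * (1 - B)⁻¹ - 1 = (1 + B) * (1 - B)⁻¹ - (1 - B) * (1 - B)⁻¹ := by rw [← e]
      _ = _ := by rw [two_smul]; noncomm_ring
  rw [cayleyInvMat, key, mul_assoc, Matrix.mul_nonsing_inv _ hu, mul_one, smul_smul]
  norm_num

theorem contDiffAt_matInv {A : Mat d} (h : IsUnit A) :
    ContDiffAt ℝ ∞ (fun B : Mat d => B⁻¹) A := by
  have e : (fun B : Mat d => B⁻¹) = Ring.inverse := by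
    funext B; exact Matrix.nonsing_inv_eq_ringInverse B
  rw [e]
  obtain ⟨u, rfl⟩ := h
  exact contDiffAt_ringInverse ℝ u

theorem contDiffAt_cayleyMat (A : Skew d) : ContDiffAt ℝ ∞ (cayleyMat (d := d)) A.1 := by
  unfold cayleyMat
  have h1 := Skew.isUnit_one_sub (half_skew A)
  have h2 : ContDiffAt ℝ ∞ (fun A : Mat d => 1 - (1 / 2 : ℝ) • A) A.1 :=
    contDiffAt_const.sub (contDiffAt_id.const_smul _)
  have h3 : ContDiffAt ℝ ∞ (fun A : Mat d => 1 + (1 / 2 : ℝ) • A) A.1 :=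
    contDiffAt_const.add (contDiffAt_id.const_smul _)
  exact h3.mul ((contDiffAt_matInv h1).comp A.1 h2)

theorem contDiffAt_cayleyInvMat {U : Mat d} (h : IsUnit (U + 1)) :
    ContDiffAt ℝ ∞ (cayleyInvMat (d := d)) U := by
  unfold cayleyInvMat
  have h2 : ContDiffAt ℝ ∞ (fun U : Mat d => U + 1) U := contDiffAt_id.add contDiffAt_const
  have h3 : ContDiffAt ℝ ∞ (fun U : Mat d => U - 1) U := contDiffAt_id.sub contDiffAt_const
  exact (h3.mul ((contDiffAt_matInv h).comp U h2)).const_smul _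

/-- The Cayley chart of `SO_d` centred at `R₀`, with inverse
`A ↦ R₀ (1 + A/2) (1 - A/2)⁻¹`. It identifies the tangent space at `1` with `Skew_d`. -/
def cayleyChart (R₀ : SO d) : OpenPartialHomeomorph (SO d) (Skew d) where
  toFun R := Skew.proj d (cayleyInvMat (R₀.1ᵀ * R.1))
  invFun A := R₀ * cayley A
  source := {R | IsUnit (R₀.1ᵀ * R.1 + 1)}
  target := univ
  map_source' _ _ := mem_univ _
  map_target' A _ := by
    change IsUnit (R₀.1ᵀ * (R₀.1 * cayleyMat A.1) + 1)
    rw [← mul_assoc, transpose_mul_self, one_mul]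
    exact isUnit_cayleyMat_add_one A
  left_inv' R hR := by
    have hU : (R₀.1ᵀ * R.1)ᵀ * (R₀.1ᵀ * R.1) = 1 := transpose_mul_self (R₀⁻¹ * R)
    apply Subtype.ext
    change R₀.1 * cayleyMat (Skew.proj d (cayleyInvMat (R₀.1ᵀ * R.1))).1 = R.1
    rw [Skew.coe_proj (cayleyInvMat_skew hU hR), cayleyMat_cayleyInvMat hU hR, ← mul_assoc,
      mul_transpose_self, one_mul]
  right_inv' A _ := by
    change Skew.proj d (cayleyInvMat (R₀.1ᵀ * (R₀.1 * cayleyMat A.1))) = A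
    rw [← mul_assoc, transpose_mul_self, one_mul, cayleyInvMat_cayleyMat, Skew.proj_coe]
  open_source := by
    have h : Continuous fun R : SO d => R₀.1ᵀ * R.1 + 1 :=
      (continuous_const.mul continuous_subtype_val).add continuous_const
    exact Units.isOpen.preimage h
  open_target := isOpen_univ
  continuousOn_toFun := by
    intro R hR
    have h : Continuous fun R : SO d => R₀.1ᵀ * R.1 := continuous_const.mul continuous_subtype_val
    have h2 : ContinuousAt (fun R : SO d => cayleyInvMat (R₀.1ᵀ * R.1)) R :=
      ContinuousAt.comp (g := cayleyInvMat) (contDiffAt_cayleyInvMat hR).continuousAt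
        h.continuousAt
    exact ((Skew.proj d).continuous.continuousAt.comp h2).continuousWithinAt
  continuousOn_invFun := by
    refine Continuous.continuousOn (Continuous.subtype_mk ?_ _)
    refine continuous_const.mul (continuous_iff_continuousAt.2 fun A => ?_)
    exact ContinuousAt.comp (g := cayleyMat) (contDiffAt_cayleyMat A).continuousAt
      continuous_subtype_val.continuousAt

/-- The manifold structure of `SO_d`, modelled on `Skew_d`, given by the Cayley charts. -/
instance : ChartedSpace (Skew d) (SO d) where
  atlas := range cayleyChart
  chartAt := cayleyChart
  mem_chart_source R := by
    change IsUnit (R.1ᵀ * R.1 + 1)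
    rw [transpose_mul_self, one_add_one_eq_two]
    have : (2 : Mat d) = (2 : ℝ) • 1 := by rw [two_smul, one_add_one_eq_two]
    rw [this]
    exact isUnit_one.smul (Units.mk0 (2 : ℝ) two_ne_zero)
  chart_mem_atlas R := mem_range_self R

instance : IsManifold 𝓘(ℝ, Skew d) ∞ (SO d) := by
  apply isManifold_of_contDiffOn
  rintro _ _ ⟨R₀, rfl⟩ ⟨R₁, rfl⟩
  intro A hA
  have hA' : IsUnit (R₁.1ᵀ * (R₀.1 * cayleyMat A.1) + 1) := by
    have := hA.1
    simp only [modelWithCornersSelf_coe_symm, preimage_id_eq, id_eq,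
      OpenPartialHomeomorph.trans_source, mem_inter_iff] at this
    exact this.2
  have h1 : ContDiffAt ℝ ∞ (fun A : Skew d => R₁.1ᵀ * (R₀.1 * cayleyMat A.1)) A :=
    contDiffAt_const.mul (contDiffAt_const.mul
      (ContDiffAt.comp A (contDiffAt_cayleyMat A) (Skew d).subtypeL.contDiff.contDiffAt))
  have h2 : ContDiffAt ℝ ∞ (fun A : Skew d =>
      Skew.proj d (cayleyInvMat (R₁.1ᵀ * (R₀.1 * cayleyMat A.1)))) A :=
    (Skew.proj d).contDiff.contDiffAt.comp A
      (ContDiffAt.comp (g := cayleyInvMat) A (contDiffAt_cayleyInvMat hA') h1)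
  exact h2.contDiffWithinAt

end SO

namespace SO

variable {d : ℕ}

/-- The rotation of `ℝ^d` with matrix `R`, as a continuous linear map. -/
def toCLM (R : SO d) : Euc d →L[ℝ] Euc d := Matrix.toEuclideanCLM (n := Fin d) (𝕜 := ℝ) R.1

theorem toCLM_mul (R S : SO d) (x : Euc d) : toCLM (R * S) x = toCLM R (toCLM S x) := by
  simp [toCLM]

theorem toCLM_one (x : Euc d) : toCLM (1 : SO d) x = x := by
  simp [toCLM]

theorem toCLM_inv_apply (R : SO d) (x : Euc d) : toCLM R⁻¹ (toCLM R x) = x := by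
  rw [← toCLM_mul, inv_mul_cancel, toCLM_one]

theorem toCLM_apply_inv (R : SO d) (x : Euc d) : toCLM R (toCLM R⁻¹ x) = x := by
  rw [← toCLM_mul, mul_inv_cancel, toCLM_one]

end SO

/-! ## The group `Isom(ℝ^d) = SO_d ⋉ ℝ^d` -/

/-- The group `Isom(ℝ^d) = SO_d ⋉ ℝ^d` of rigid motions `(R, T)`. -/
def Isom (d : ℕ) : Type := SO d × Euc d

namespace Isom

variable {d : ℕ}

/-- The rotation part. -/
def rot (g : Isom d) : SO d := g.1

/-- The translation part. -/
def trans (g : Isom d) : Euc d := g.2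

@[ext] theorem ext {g h : Isom d} (h1 : g.rot = h.rot) (h2 : g.trans = h.trans) : g = h :=
  Prod.ext h1 h2

/-- The model `Skew_d × ℝ^d` of the Lie group `Isom(ℝ^d)`. -/
abbrev model (d : ℕ) : ModelWithCorners ℝ (Skew d × Euc d) (ModelProd (Skew d) (Euc d)) :=
  𝓘(ℝ, Skew d).prod 𝓘(ℝ, Euc d)

instance : TopologicalSpace (Isom d) := inferInstanceAs (TopologicalSpace (SO d × Euc d))

instance : ChartedSpace (ModelProd (Skew d) (Euc d)) (Isom d) :=
  inferInstanceAs (ChartedSpace (ModelProd (Skew d) (Euc d)) (SO d × Euc d))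

instance : IsManifold (model d) ∞ (Isom d) :=
  inferInstanceAs (IsManifold (model d) ∞ (SO d × Euc d))

/-- `(R', T') (R, T) = (R' R, R' T + T')`. -/
instance : Mul (Isom d) := ⟨fun g h => (g.rot * h.rot, SO.toCLM g.rot h.trans + g.trans)⟩

instance : One (Isom d) := ⟨((1 : SO d), (0 : Euc d))⟩

instance : Inv (Isom d) := ⟨fun g => (g.rot⁻¹, -SO.toCLM g.rot⁻¹ g.trans)⟩

theorem rot_mul (g h : Isom d) : (g * h).rot = g.rot * h.rot := rfl

theorem trans_mul (g h : Isom d) : (g * h).trans = SO.toCLM g.rot h.trans + g.trans := rfl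

theorem rot_one : (1 : Isom d).rot = 1 := rfl

theorem trans_one : (1 : Isom d).trans = 0 := rfl

theorem rot_inv (g : Isom d) : (g⁻¹).rot = g.rot⁻¹ := rfl

theorem trans_inv (g : Isom d) : (g⁻¹).trans = -SO.toCLM g.rot⁻¹ g.trans := rfl

instance : Group (Isom d) where
  mul_assoc a b c := by
    ext1
    · simp only [rot_mul, mul_assoc]
    · simp only [rot_mul, trans_mul, SO.toCLM_mul, map_add, add_assoc]
  one_mul a := by
    ext1
    · simp only [rot_mul, rot_one, one_mul]
    · simp only [trans_mul, rot_one, trans_one, SO.toCLM_one, add_zero]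
  mul_one a := by
    ext1
    · simp only [rot_mul, rot_one, mul_one]
    · simp only [trans_mul, trans_one, map_zero, zero_add]
  inv_mul_cancel a := by
    ext1
    · simp only [rot_mul, rot_inv, inv_mul_cancel, rot_one]
    · simp only [trans_mul, rot_inv, trans_inv, add_neg_cancel, trans_one]

/-- The action of `Isom(ℝ^d)` on `ℝ^d`: `(R, T) · x = R x + T`. -/
instance : MulAction (Isom d) (Euc d) where
  smul g x := SO.toCLM g.rot x + g.trans
  one_smul x := by
    change SO.toCLM (1 : Isom d).rot x + (1 : Isom d).trans = x
    rw [rot_one, trans_one, SO.toCLM_one, add_zero]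
  mul_smul g h x := by
    change SO.toCLM (g * h).rot x + (g * h).trans
      = SO.toCLM g.rot (SO.toCLM h.rot x + h.trans) + g.trans
    rw [rot_mul, trans_mul, SO.toCLM_mul, map_add, add_assoc]

theorem smul_def (g : Isom d) (x : Euc d) : g • x = SO.toCLM g.rot x + g.trans := rfl

theorem inv_smul_def (g : Isom d) (x : Euc d) :
    g⁻¹ • x = SO.toCLM g.rot⁻¹ x - SO.toCLM g.rot⁻¹ g.trans := by
  rw [smul_def, rot_inv, trans_inv, sub_eq_add_neg]

theorem contDiff_smul (g : Isom d) {n : ℕ∞ω} : ContDiff ℝ n (fun x : Euc d => g • x) :=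
  (SO.toCLM g.rot).contDiff.add contDiff_const

/-- The homeomorphism of `ℝ^d` given by a rigid motion. -/
def toHomeo (g : Isom d) : Euc d ≃ₜ Euc d where
  toFun x := g • x
  invFun x := g⁻¹ • x
  left_inv x := inv_smul_smul g x
  right_inv x := smul_inv_smul g x
  continuous_toFun := (contDiff_smul g (n := 0)).continuous
  continuous_invFun := (contDiff_smul g⁻¹ (n := 0)).continuous

end Isom

/-! ## The Banach space `C_0^k(ℝ^d, ℝ^d)` -/

/-- `C^k` vector fields on `ℝ^d` which vanish at infinity together with their derivatives of order
up to `k`. -/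
def c0Submodule (k d : ℕ) : Submodule ℝ (Euc d → Euc d) where
  carrier := {u | ContDiff ℝ k u ∧
    ∀ i ≤ k, Tendsto (iteratedFDeriv ℝ i u) (cocompact (Euc d)) (𝓝 0)}
  add_mem' := by
    rintro u v ⟨hu, hu'⟩ ⟨hv, hv'⟩
    refine ⟨hu.add hv, fun i hi => ?_⟩
    have hi' : (i : ℕ∞ω) ≤ k := by exact_mod_cast hi
    rw [iteratedFDeriv_add (hu.of_le hi') (hv.of_le hi'), ← add_zero (0 : Euc d [×i]→L[ℝ] Euc d)]
    exact (hu' i hi).add (hv' i hi)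
  zero_mem' := by
    refine ⟨contDiff_const, fun i _ => ?_⟩
    have : iteratedFDeriv ℝ i (0 : Euc d → Euc d) = 0 := iteratedFDeriv_fun_zero
    rw [this]
    exact tendsto_const_nhds
  smul_mem' := by
    rintro c u ⟨hu, hu'⟩
    refine ⟨hu.const_smul c, fun i hi => ?_⟩
    have hi' : (i : ℕ∞ω) ≤ k := by exact_mod_cast hi
    have : iteratedFDeriv ℝ i (c • u) = c • iteratedFDeriv ℝ i u :=
      funext fun x => iteratedFDeriv_const_smul_apply (hu.of_le hi').contDiffAt
    rw [this, ← smul_zero c]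
    exact (hu' i hi).const_smul c

/-- The space `C_0^k(ℝ^d, ℝ^d)`. -/
def C0k (k d : ℕ) : Type := c0Submodule k d

namespace C0k

variable {k d : ℕ}

instance : CoeFun (C0k k d) (fun _ => Euc d → Euc d) := ⟨fun u => u.1⟩

instance instAddCommGroup : AddCommGroup (C0k k d) := inferInstanceAs (AddCommGroup (c0Submodule k d))

instance instModule : Module ℝ (C0k k d) := inferInstanceAs (Module ℝ (c0Submodule k d))

/-- A function satisfying the defining conditions, as an element of `C_0^k(ℝ^d, ℝ^d)`. -/
def of {u : Euc d → Euc d} (hu : u ∈ c0Submodule k d) : C0k k d := ⟨u, hu⟩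

theorem contDiff (u : C0k k d) : ContDiff ℝ k u := u.2.1

theorem tendsto (u : C0k k d) {i : ℕ} (hi : i ≤ k) :
    Tendsto (iteratedFDeriv ℝ i u) (cocompact (Euc d)) (𝓝 0) := u.2.2 i hi

theorem add_apply (u v : C0k k d) (x : Euc d) : (u + v) x = u x + v x := rfl

theorem zero_apply (x : Euc d) : (0 : C0k k d) x = 0 := rfl

theorem sub_apply (u v : C0k k d) (x : Euc d) : (u - v) x = u x - v x := rfl

/-- The family of the derivatives of order `0, …, k`. -/
def jet (k d : ℕ) :
    C0k k d →ₗ[ℝ] ((i : Fin (k + 1)) → ZeroAtInftyContinuousMap (Euc d) (Euc d [×i]→L[ℝ] Euc d)) where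
  toFun u i :=
    ⟨⟨iteratedFDeriv ℝ i u, u.contDiff.continuous_iteratedFDeriv
      (by exact_mod_cast Nat.lt_succ_iff.1 i.2)⟩, u.tendsto (Nat.lt_succ_iff.1 i.2)⟩
  map_add' u v := by
    funext i
    have hi' : ((i : ℕ) : ℕ∞ω) ≤ k := by exact_mod_cast Nat.lt_succ_iff.1 i.2
    ext1 x
    exact iteratedFDeriv_add_apply (u.contDiff.of_le hi').contDiffAt
      (v.contDiff.of_le hi').contDiffAt
  map_smul' c u := by
    funext i
    have hi' : ((i : ℕ) : ℕ∞ω) ≤ k := by exact_mod_cast Nat.lt_succ_iff.1 i.2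
    ext1 x
    exact iteratedFDeriv_const_smul_apply (u.contDiff.of_le hi').contDiffAt

theorem jet_apply (u : C0k k d) (i : Fin (k + 1)) (x : Euc d) :
    jet k d u i x = iteratedFDeriv ℝ i u x := rfl

theorem jet_injective : Function.Injective (jet k d) := by
  intro u v h
  apply Subtype.ext
  funext x
  have h0 : iteratedFDeriv ℝ 0 u x = iteratedFDeriv ℝ 0 v x :=
    congrArg (fun J => J 0 x) h
  have := congrArg (fun L => L 0) h0
  simpa only [iteratedFDeriv_zero_apply] using this

/-- The norm `max_{i ≤ k} sup_x ‖D^i u(x)‖`. -/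
instance : NormedAddCommGroup (C0k k d) :=
  NormedAddCommGroup.induced (C0k k d) _ (jet k d) jet_injective

instance : NormedSpace ℝ (C0k k d) := NormedSpace.induced ℝ (C0k k d) _ (jet k d)

theorem norm_iteratedFDeriv_le (u : C0k k d) {i : ℕ} (hi : i ≤ k) (x : Euc d) :
    ‖iteratedFDeriv ℝ i u x‖ ≤ ‖u‖ := by
  have h1 : ‖(jet k d u ⟨i, Nat.lt_succ_iff.2 hi⟩).toBCF x‖ ≤
      ‖(jet k d u ⟨i, Nat.lt_succ_iff.2 hi⟩).toBCF‖ :=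
    BoundedContinuousFunction.norm_coe_le_norm _ x
  exact h1.trans (norm_le_pi_norm (jet k d u) ⟨i, Nat.lt_succ_iff.2 hi⟩)

theorem norm_apply_le (u : C0k k d) (x : Euc d) : ‖u x‖ ≤ ‖u‖ := by
  rw [← norm_iteratedFDeriv_zero (𝕜 := ℝ)]
  exact u.norm_iteratedFDeriv_le (Nat.zero_le k) x

/-- The inclusion `C_0^{k+l} ⊂ C_0^k`. -/
def incl (k l : ℕ) (u : C0k (k + l) d) : C0k k d :=
  ⟨u.1, u.2.1.of_le (by exact_mod_cast Nat.le_add_right k l),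
    fun i hi => u.2.2 i (hi.trans (Nat.le_add_right k l))⟩

end C0k

/-! ### Composition and inversion -/

section Composition

variable {k d : ℕ}

/-- The derivatives of order `1, …, k` of `f` are bounded. -/
def BddDerivs (k : ℕ) {d : ℕ} (f : Euc d → Euc d) : Prop :=
  ∃ B : ℝ, ∀ i, 1 ≤ i → i ≤ k → ∀ x, ‖iteratedFDeriv ℝ i f x‖ ≤ B

theorem bddDerivs_clm_add_const (L : Euc d →L[ℝ] Euc d) (c : Euc d) :
    BddDerivs k (fun x => L x + c) := by
  refine ⟨‖L‖, fun i hi _ x => ?_⟩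
  obtain ⟨j, rfl⟩ : ∃ j, i = j + 1 := ⟨i - 1, by omega⟩
  rw [← norm_iteratedFDeriv_fderiv]
  have : fderiv ℝ (fun x => L x + c) = fun _ => L := by
    funext y; rw [fderiv_add_const]; exact L.fderiv
  rw [this]
  rcases Nat.eq_zero_or_pos j with rfl | hj
  · rw [norm_iteratedFDeriv_zero]
  · rw [iteratedFDeriv_const_of_ne (by omega)]
    simp

theorem bddDerivs_id_add {u : Euc d → Euc d} (hu : u ∈ c0Submodule k d) :
    BddDerivs k (fun x => x + u x) := by
  obtain ⟨B, hB⟩ := bddDerivs_clm_add_const (k := k) (ContinuousLinearMap.id ℝ (Euc d)) 0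
  refine ⟨B + ‖C0k.of hu‖, fun i hi hik x => ?_⟩
  have hik' : (i : ℕ∞ω) ≤ k := by exact_mod_cast hik
  have e : (fun x => x + u x)
      = (fun x => ContinuousLinearMap.id ℝ (Euc d) x + 0) + u := by
    funext y; simp
  rw [e, iteratedFDeriv_add_apply
    ((ContinuousLinearMap.contDiff _).add contDiff_const).contDiffAt
    (hu.1.of_le hik').contDiffAt]
  exact (norm_add_le _ _).trans (add_le_add (hB i hi hik x)
    (C0k.norm_iteratedFDeriv_le (C0k.of hu) hik x))

theorem tendsto_id_add {u : Euc d → Euc d} (hu : u ∈ c0Submodule k d) :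
    Tendsto (fun x => x + u x) (cocompact (Euc d)) (cocompact (Euc d)) := by
  rw [← Metric.cobounded_eq_cocompact, ← comap_norm_atTop, tendsto_comap_iff, comap_norm_atTop]
  refine tendsto_atTop_mono (f := fun x => ‖x‖ + -‖C0k.of hu‖) (fun x => ?_)
    (tendsto_atTop_add_const_right _ _ tendsto_norm_cobounded_atTop)
  have h1 := C0k.norm_apply_le (C0k.of hu) x
  have h2 : ‖x‖ ≤ ‖x + u x‖ + ‖u x‖ := by
    have := norm_sub_le (x + u x) (u x)
    rwa [add_sub_cancel_right] at this
  change ‖x‖ + -‖C0k.of hu‖ ≤ ‖x + u x‖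
  change ‖u x‖ ≤ _ at h1
  linarith

theorem c0_comp {u f : Euc d → Euc d} (hu : u ∈ c0Submodule k d) (hf : ContDiff ℝ k f)
    (hb : BddDerivs k f) (hc : Tendsto f (cocompact (Euc d)) (cocompact (Euc d))) :
    (fun x => u (f x)) ∈ c0Submodule k d := by
  refine ⟨hu.1.comp hf, fun n hn => ?_⟩
  obtain ⟨B, hB⟩ := hb
  set D : ℝ := max B 1
  have hD1 : 1 ≤ D := le_max_right _ _
  have hn' : (n : ℕ∞ω) ≤ k := by exact_mod_cast hn
  have key : ∀ x, ‖iteratedFDeriv ℝ n (fun x => u (f x)) x‖ ≤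
      n.factorial * (∑ i ∈ Finset.range (n + 1), ‖iteratedFDeriv ℝ i u (f x)‖) * D ^ n := by
    intro x
    refine norm_iteratedFDeriv_comp_le hu.1 hf hn' x (fun i hi => ?_) (fun i hi hin => ?_)
    · exact Finset.single_le_sum (f := fun i => ‖iteratedFDeriv ℝ i u (f x)‖)
        (fun _ _ => norm_nonneg _) (Finset.mem_range.2 (Nat.lt_succ_iff.2 hi))
    · exact (hB i hi (hin.trans hn) x).trans ((le_max_left _ _).trans
        (le_self_pow₀ hD1 (by omega)))
  refine squeeze_zero_norm key ?_
  have hS : Tendsto (fun x => ∑ i ∈ Finset.range (n + 1), ‖iteratedFDeriv ℝ i u (f x)‖)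
      (cocompact (Euc d)) (𝓝 0) := by
    rw [show (0 : ℝ) = ∑ i ∈ Finset.range (n + 1), (0 : ℝ) by simp]
    refine tendsto_finsetSum _ fun i hi => ?_
    have := ((hu.2 i ((Nat.lt_succ_iff.1 (Finset.mem_range.1 hi)).trans hn)).comp hc).norm
    simpa using this
  have := (hS.const_mul (n.factorial : ℝ)).mul_const (D ^ n)
  simpa using this

theorem c0_clm {u : Euc d → Euc d} (hu : u ∈ c0Submodule k d) (L : Euc d →L[ℝ] Euc d) :
    (fun x => L (u x)) ∈ c0Submodule k d := by
  refine ⟨L.contDiff.comp hu.1, fun n hn => ?_⟩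
  have hn' : (n : ℕ∞ω) ≤ k := by exact_mod_cast hn
  refine squeeze_zero_norm (fun x => L.norm_iteratedFDeriv_comp_left hu.1.contDiffAt hn') ?_
  have := (hu.2 n hn).norm.const_mul ‖L‖
  simpa using this

/-- `f` is a `C^1` diffeomorphism of `ℝ^d`. -/
def IsDiffC1 {d : ℕ} (f : Euc d → Euc d) : Prop :=
  ContDiff ℝ 1 f ∧ ∃ g : Euc d → Euc d,
    ContDiff ℝ 1 g ∧ Function.LeftInverse g f ∧ Function.RightInverse g f

theorem fderiv_comp_inverse {f g : Euc d → Euc d} (hf : ContDiff ℝ 1 f) (hg : ContDiff ℝ 1 g)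
    (h : Function.RightInverse g f) (y : Euc d) :
    (fderiv ℝ f (g y)).comp (fderiv ℝ g y) = ContinuousLinearMap.id ℝ (Euc d) := by
  have h1 := (hf.differentiable one_ne_zero (g y)).hasFDerivAt.comp y
    (hg.differentiable one_ne_zero y).hasFDerivAt
  have h2 : f ∘ g = id := funext h
  rw [h2] at h1
  exact h1.unique (hasFDerivAt_id y)

/-- The derivative of a diffeomorphism as a continuous linear equivalence. -/
def fderivEquiv {f g : Euc d → Euc d} (hf : ContDiff ℝ 1 f) (hg : ContDiff ℝ 1 g)
    (hl : Function.LeftInverse g f) (hr : Function.RightInverse g f) (x : Euc d) :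
    Euc d ≃L[ℝ] Euc d :=
  ContinuousLinearEquiv.equivOfInverse (fderiv ℝ f x) (fderiv ℝ g (f x))
    (fun v => by
      have := fderiv_comp_inverse hg hf hl x
      exact congrArg (fun L => L v) this)
    (fun v => by
      have := fderiv_comp_inverse hf hg hr (f x)
      rw [hl x] at this
      exact congrArg (fun L => L v) this)

theorem fderivEquiv_coe {f g : Euc d → Euc d} (hf : ContDiff ℝ 1 f) (hg : ContDiff ℝ 1 g)
    (hl : Function.LeftInverse g f) (hr : Function.RightInverse g f) (x : Euc d) :
    (fderivEquiv hf hg hl hr x : Euc d →L[ℝ] Euc d) = fderiv ℝ f x := rfl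

theorem contDiff_inverse {n : ℕ∞ω} {f g : Euc d → Euc d} (hfn : ContDiff ℝ n f)
    (hf : ContDiff ℝ 1 f) (hg : ContDiff ℝ 1 g)
    (hl : Function.LeftInverse g f) (hr : Function.RightInverse g f) : ContDiff ℝ n g := by
  let e : Euc d ≃ₜ Euc d := ⟨⟨f, g, hl, hr⟩, hf.continuous, hg.continuous⟩
  exact e.contDiff_symm (f₀' := fderivEquiv hf hg hl hr)
    (fun a => (hf.differentiable one_ne_zero a).hasFDerivAt) hfn

theorem inverse_bddDerivs [NeZero k] {u g : Euc d → Euc d} (hu : u ∈ c0Submodule k d)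
    (hg : ContDiff ℝ 1 g) (hl : Function.LeftInverse g (fun x => x + u x))
    (hr : Function.RightInverse g (fun x => x + u x)) : BddDerivs k g := by
  have hk : 1 ≤ k := Nat.one_le_iff_ne_zero.2 (NeZero.ne k)
  set f : Euc d → Euc d := fun x => x + u x with hfdef
  have hfk : ContDiff ℝ k f := contDiff_id.add hu.1
  have hf : ContDiff ℝ 1 f := hfk.of_le (by exact_mod_cast hk)
  have hgk : ContDiff ℝ k g := contDiff_inverse hfk hf hg hl hr
  obtain ⟨B, hB⟩ := bddDerivs_id_add hu
  let t : Set (Euc d →L[ℝ] Euc d) := {L | IsUnit L}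
  have ht : IsOpen t := Units.isOpen
  have hInv : ContDiffOn ℝ ∞ (Ring.inverse : (Euc d →L[ℝ] Euc d) → _) t := by
    rintro _ ⟨L, rfl⟩
    exact (contDiffAt_ringInverse ℝ L).contDiffWithinAt
  have hfu : ∀ x, IsUnit (fderiv ℝ f x) := fun x =>
    ⟨ContinuousLinearEquiv.unitsEquiv ℝ (Euc d) |>.symm (fderivEquiv hf hg hl hr x), rfl⟩
  have hgf : ∀ y, fderiv ℝ g y = Ring.inverse (fderiv ℝ f (g y)) := by
    intro y
    have h1 : fderiv ℝ f (g y) * fderiv ℝ g y = 1 := fderiv_comp_inverse hf hg hr y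
    have h2 := Ring.inverse_mul_cancel _ (hfu (g y))
    calc fderiv ℝ g y = Ring.inverse (fderiv ℝ f (g y)) * (fderiv ℝ f (g y) * fderiv ℝ g y) := by
          rw [← mul_assoc, h2, one_mul]
      _ = _ := by rw [h1, mul_one]
  -- the values of the derivative of `f` lie in a compact set of invertible maps
  have hfd : fderiv ℝ f = fun x => 1 + fderiv ℝ u x := by
    funext x
    exact (((hasFDerivAt_id x).add (((hu.1.of_le (by exact_mod_cast hk) :
      ContDiff ℝ 1 u).differentiable one_ne_zero x).hasFDerivAt)).fderiv)
  have hlim : Tendsto (fderiv ℝ f) (cocompact (Euc d)) (𝓝 1) := by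
    rw [hfd]
    have h1 : Tendsto (fderiv ℝ u) (cocompact (Euc d)) (𝓝 0) := by
      rw [tendsto_zero_iff_norm_tendsto_zero]
      have := (hu.2 1 hk).norm
      simpa only [norm_iteratedFDeriv_one, norm_zero] using this
    simpa using h1.const_add (1 : Euc d →L[ℝ] Euc d)
  have hK := hlim.isCompact_insert_range_of_cocompact (hf.continuous_fderiv one_ne_zero)
  have hKt : insert 1 (range (fderiv ℝ f)) ⊆ t := by
    rintro _ (rfl | ⟨x, rfl⟩)
    · exact isUnit_one
    · exact hfu x
  have hC : ∀ i : ℕ, ∃ C : ℝ, ∀ x,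
      ‖iteratedFDerivWithin ℝ i Ring.inverse t (fderiv ℝ f x)‖ ≤ C := by
    intro i
    have hc : ContinuousOn (iteratedFDerivWithin ℝ i Ring.inverse t) t :=
      hInv.continuousOn_iteratedFDerivWithin (by exact_mod_cast le_top) ht.uniqueDiffOn
    obtain ⟨C, hC⟩ := hK.exists_bound_of_continuousOn (hc.mono hKt)
    exact ⟨C, fun x => hC _ (mem_insert_of_mem _ (mem_range_self x))⟩
  choose C hC using hC
  -- the derivatives of `x ↦ (D f (x))⁻¹` are bounded
  let G : Euc d → (Euc d →L[ℝ] Euc d) := fun x => Ring.inverse (fderiv ℝ f x)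
  have hfd' : ∀ n : ℕ, n + 1 ≤ k → ContDiff ℝ n (fderiv ℝ f) := fun n hn =>
    hfk.fderiv_right (by exact_mod_cast hn)
  have hGc : ∀ n : ℕ, n + 1 ≤ k → ContDiff ℝ n G := by
    intro n hn
    rw [contDiff_iff_contDiffAt]
    intro x
    exact ContDiffAt.comp x ((hInv.contDiffAt (ht.mem_nhds (hfu x))).of_le
      (by exact_mod_cast le_top)) (hfd' n hn).contDiffAt
  have hGb : ∀ n : ℕ, n + 1 ≤ k → ∃ M : ℝ, ∀ x, ‖iteratedFDeriv ℝ n G x‖ ≤ M := by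
    intro n hn
    refine ⟨n.factorial * (∑ i ∈ Finset.range (n + 1), |C i|) * (max B 1) ^ n, fun x => ?_⟩
    rw [← iteratedFDerivWithin_univ]
    refine norm_iteratedFDerivWithin_comp_le (t := t) (N := n) (hInv.of_le (by exact_mod_cast le_top))
      (hfd' n hn).contDiffOn le_rfl ht.uniqueDiffOn uniqueDiffOn_univ (fun x _ => hfu x)
      (mem_univ x) (fun i hi => ?_) (fun i hi hin => ?_)
    · exact (hC i x).trans ((le_abs_self _).trans (Finset.single_le_sum (f := fun i => |C i|)
        (fun _ _ => abs_nonneg _) (Finset.mem_range.2 (Nat.lt_succ_iff.2 hi))))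
    · rw [iteratedFDerivWithin_univ, norm_iteratedFDeriv_fderiv]
      exact (hB (i + 1) (by omega) (by omega) x).trans ((le_max_left _ _).trans
        (le_self_pow₀ (le_max_right _ _) (by omega)))
  choose! M hM using hGb
  -- induction on the order of differentiation
  have main : ∀ n : ℕ, n ≤ k → BddDerivs n g := by
    intro n
    induction n with
    | zero => exact fun _ => ⟨0, fun i h1 h2 => by omega⟩
    | succ n ih =>
      intro hn
      obtain ⟨A, hA⟩ := ih (by omega)
      let P : ℝ := n.factorial * (∑ i ∈ Finset.range (n + 1), |M i|) * (max A 1) ^ n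
      refine ⟨max A P, fun i h1 h2 y => ?_⟩
      rcases Nat.lt_or_ge n i with h | h
      · obtain rfl : i = n + 1 := by omega
        refine le_trans ?_ (le_max_right _ _)
        rw [← norm_iteratedFDeriv_fderiv]
        have : fderiv ℝ g = G ∘ g := funext hgf
        rw [this]
        refine norm_iteratedFDeriv_comp_le (N := n) (hGc n hn)
          (hgk.of_le (by exact_mod_cast (by omega : n ≤ k))) le_rfl y
          (fun j hj => ?_) (fun j hj hjn => ?_)
        · exact (hM j (by omega) (g y)).trans ((le_abs_self _).trans
            (Finset.single_le_sum (f := fun i => |M i|)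
            (fun _ _ => abs_nonneg _) (Finset.mem_range.2 (Nat.lt_succ_iff.2 hj))))
        · exact (hA j hj hjn y).trans ((le_max_left _ _).trans
            (le_self_pow₀ (le_max_right _ _) (by omega)))
      · exact (hA i h1 h y).trans (le_max_left _ _)
  exact main k le_rfl

theorem inverse_mem [NeZero k] {u g : Euc d → Euc d} (hu : u ∈ c0Submodule k d)
    (hg : ContDiff ℝ 1 g) (hl : Function.LeftInverse g (fun x => x + u x))
    (hr : Function.RightInverse g (fun x => x + u x)) :
    (fun y => g y - y) ∈ c0Submodule k d := by
  have hk : 1 ≤ k := Nat.one_le_iff_ne_zero.2 (NeZero.ne k)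
  have hfk : ContDiff ℝ k (fun x => x + u x) := contDiff_id.add hu.1
  have hf : ContDiff ℝ 1 (fun x => x + u x) := hfk.of_le (by exact_mod_cast hk)
  let e : Euc d ≃ₜ Euc d := ⟨⟨g, _, hr, hl⟩, hg.continuous, hf.continuous⟩
  have h1 := c0_comp hu (contDiff_inverse hfk hf hg hl hr) (inverse_bddDerivs hu hg hl hr)
    e.isClosedEmbedding.tendsto_cocompact
  have h2 : (fun y => g y - y) = -(fun y => u (g y)) := by
    funext y
    have h3 : g y + u (g y) = y := hr y
    change g y - y = -u (g y)
    nth_rewrite 2 [← h3]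
    abel
  rw [h2]
  exact (c0Submodule k d).neg_mem h1

/-- A `C^1`-small perturbation of the identity is a diffeomorphism. -/
theorem isDiffC1_id_add {h : Euc d → Euc d} (hh : ContDiff ℝ 1 h)
    (hs : ∀ x, ‖fderiv ℝ h x‖ ≤ 1 / 2) : IsDiffC1 (fun x => x + h x) := by
  have hc : ContDiff ℝ 1 (fun x => x + h x) := contDiff_id.add hh
  refine ⟨hc, ?_⟩
  rcases subsingleton_or_nontrivial (Euc d) with hsub | hnt
  · exact ⟨id, contDiff_id, fun x => Subsingleton.elim _ _, fun x => Subsingleton.elim _ _⟩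
  have hlip : LipschitzWith (1 / 2) h :=
    lipschitzWith_of_nnnorm_fderiv_le (hh.differentiable one_ne_zero)
      (fun x => by rw [← NNReal.coe_le_coe]; simpa using hs x)
  have happ : ApproximatesLinearOn (fun x => x + h x)
      ((ContinuousLinearEquiv.refl ℝ (Euc d) : Euc d ≃L[ℝ] Euc d) : Euc d →L[ℝ] Euc d)
      univ (1 / 2) := by
    rw [ApproximatesLinearOn.approximatesLinearOn_iff_lipschitzOnWith, lipschitzOnWith_univ]
    have e : ((fun x => x + h x) -
        ⇑((ContinuousLinearEquiv.refl ℝ (Euc d) : Euc d ≃L[ℝ] Euc d) : Euc d →L[ℝ] Euc d)) = h := by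
      funext x
      simp
    rw [e]
    exact hlip
  have hN : (1 / 2 : NNReal) <
      ‖((ContinuousLinearEquiv.refl ℝ (Euc d)).symm : Euc d →L[ℝ] Euc d)‖₊⁻¹ := by
    have : ‖((ContinuousLinearEquiv.refl ℝ (Euc d)).symm : Euc d →L[ℝ] Euc d)‖₊ = 1 := by
      rw [← NNReal.coe_inj]
      exact ContinuousLinearMap.norm_id
    rw [this, inv_one]
    exact NNReal.half_lt_self one_ne_zero
  let e := happ.toHomeomorph _ (Or.inr hN)
  have hder : ∀ x, ∃ L : Euc d ≃L[ℝ] Euc d,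
      HasFDerivAt (fun x => x + h x) (L : Euc d →L[ℝ] Euc d) x := by
    intro x
    have h1 := (hasFDerivAt_id x).add (hh.differentiable one_ne_zero x).hasFDerivAt
    have h2 : ‖-fderiv ℝ h x‖ < 1 := by
      rw [norm_neg]; exact (hs x).trans_lt (by norm_num)
    refine ⟨ContinuousLinearEquiv.unitsEquiv ℝ (Euc d) (Units.oneSub (-fderiv ℝ h x) h2), ?_⟩
    have e : ((ContinuousLinearEquiv.unitsEquiv ℝ (Euc d) (Units.oneSub (-fderiv ℝ h x) h2) :
        Euc d ≃L[ℝ] Euc d) : Euc d →L[ℝ] Euc d)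
        = ContinuousLinearMap.id ℝ (Euc d) + fderiv ℝ h x := by
      apply ContinuousLinearMap.ext
      intro v
      change (1 - -fderiv ℝ h x) v = _
      rw [sub_neg_eq_add]
      rfl
    rw [e]
    exact h1
  choose L hL using hder
  exact ⟨e.symm, e.contDiff_symm (f₀' := L) hL hc, e.left_inv, e.right_inv⟩

theorem IsDiffC1.comp {f g : Euc d → Euc d} (hf : IsDiffC1 f) (hg : IsDiffC1 g) :
    IsDiffC1 (fun x => f (g x)) := by
  obtain ⟨hf, f', hf', hfl, hfr⟩ := hf
  obtain ⟨hg, g', hg', hgl, hgr⟩ := hg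
  exact ⟨hf.comp hg, fun x => g' (f' x), hg'.comp hf',
    fun x => by simp only [hfl (g x), hgl x], fun x => by simp only [hgr (f' x), hfr x]⟩

end Composition

/-! ## The group `Diff_{C_0^k}(ℝ^d)` -/

/-- The set of `u ∈ C_0^k(ℝ^d, ℝ^d)` such that `id + u` is a `C^1` diffeomorphism of `ℝ^d`. It is
open in `C_0^k(ℝ^d, ℝ^d)`. -/
def diffOpens (k d : ℕ) [NeZero k] : TopologicalSpace.Opens (C0k k d) where
  carrier := {u | IsDiffC1 (fun x => x + u x)}
  is_open' := by
    have hk : 1 ≤ k := Nat.one_le_iff_ne_zero.2 (NeZero.ne k)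
    rw [Metric.isOpen_iff]
    rintro u ⟨hf, g, hg, hl, hr⟩
    obtain ⟨B, hB⟩ := inverse_bddDerivs u.2 hg hl hr
    have hB' : ∀ y, ‖fderiv ℝ g y‖ ≤ max B 1 := fun y => by
      rw [← norm_iteratedFDeriv_one]
      exact (hB 1 le_rfl hk y).trans (le_max_left _ _)
    have hBpos : 0 < max B 1 := lt_of_lt_of_le one_pos (le_max_right _ _)
    refine ⟨1 / (2 * max B 1), by positivity, fun v hv => ?_⟩
    have hw : ContDiff ℝ 1 (v - u : C0k k d) :=
      (v - u : C0k k d).contDiff.of_le (by exact_mod_cast hk)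
    have hsmall : IsDiffC1 (fun y => y + (v - u : C0k k d) (g y)) := by
      refine isDiffC1_id_add (hw.comp hg) fun y => ?_
      rw [fderiv_fun_comp y (hw.differentiable one_ne_zero _) (hg.differentiable one_ne_zero y)]
      have h1 : ‖fderiv ℝ (v - u : C0k k d) (g y)‖ ≤ 1 / (2 * max B 1) := by
        rw [← norm_iteratedFDeriv_one]
        refine ((v - u : C0k k d).norm_iteratedFDeriv_le hk _).trans ?_
        rw [← dist_eq_norm]
        exact (Metric.mem_ball.1 hv).le
      calc _ ≤ ‖fderiv ℝ (v - u : C0k k d) (g y)‖ * ‖fderiv ℝ g y‖ :=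
            ContinuousLinearMap.opNorm_comp_le _ _
        _ ≤ 1 / (2 * max B 1) * max B 1 := by gcongr; exact hB' y
        _ = 1 / 2 := by field_simp
    have := hsmall.comp ⟨hf, g, hg, hl, hr⟩
    have e : (fun x => x + v x)
        = fun x => (x + u x) + (v - u : C0k k d) (g (x + u x)) := by
      funext x
      have h3 : g (x + u x) = x := hl x
      rw [h3, C0k.sub_apply]
      abel
    change IsDiffC1 (fun x => x + v x)
    rw [e]
    exact this

/-- The group `Diff_{C_0^k}(ℝ^d) = (id + C_0^k(ℝ^d, ℝ^d)) ∩ Diff^1(ℝ^d)`. An element `φ` is encoded by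
`φ - id`, which makes it an open subset of the Banach space `C_0^k(ℝ^d, ℝ^d)`. -/
def Diff0 (k d : ℕ) [NeZero k] : Type := diffOpens k d

namespace Diff0

variable {k d : ℕ} [NeZero k]

instance : TopologicalSpace (Diff0 k d) := inferInstanceAs (TopologicalSpace (diffOpens k d))

instance : ChartedSpace (C0k k d) (Diff0 k d) :=
  inferInstanceAs (ChartedSpace (C0k k d) (diffOpens k d))

instance : IsManifold 𝓘(ℝ, C0k k d) ∞ (Diff0 k d) :=
  inferInstanceAs (IsManifold 𝓘(ℝ, C0k k d) ∞ (diffOpens k d))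

/-- The displacement `φ - id`. -/
def disp (φ : Diff0 k d) : C0k k d := φ.1

/-- An element `φ` as a map, `φ(x) = x + (φ - id)(x)`. -/
instance : CoeFun (Diff0 k d) (fun _ => Euc d → Euc d) := ⟨fun φ x => x + φ.disp x⟩

/-- The element of `Diff_{C_0^k}(ℝ^d)` given by a map `f` with `f - id ∈ C_0^k` and
`f ∈ Diff^1(ℝ^d)`. -/
def ofMap (f : Euc d → Euc d) (h1 : (fun x => f x - x) ∈ c0Submodule k d) (h2 : IsDiffC1 f) :
    Diff0 k d :=
  ⟨⟨fun x => f x - x, h1⟩, by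
    change IsDiffC1 (fun x => x + (f x - x))
    simpa only [add_sub_cancel] using h2⟩

theorem ofMap_apply (f : Euc d → Euc d) (h1 : (fun x => f x - x) ∈ c0Submodule k d)
    (h2 : IsDiffC1 f) (x : Euc d) : ofMap f h1 h2 x = f x :=
  add_sub_cancel x (f x)

theorem isDiffC1 (φ : Diff0 k d) : IsDiffC1 φ := φ.2

theorem contDiff (φ : Diff0 k d) : ContDiff ℝ k φ := contDiff_id.add φ.disp.contDiff

@[ext] theorem ext {φ ψ : Diff0 k d} (h : ∀ x, φ x = ψ x) : φ = ψ := by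
  apply Subtype.ext
  apply Subtype.ext
  funext x
  exact add_left_cancel (h x)

/-- The product is the composition of maps. -/
instance : Mul (Diff0 k d) where
  mul φ ψ := ofMap (fun x => φ (ψ x))
    (by
      have h1 := c0_comp φ.disp.2 ψ.contDiff (bddDerivs_id_add ψ.disp.2) (tendsto_id_add ψ.disp.2)
      have h2 := (c0Submodule k d).add_mem ψ.disp.2 h1
      convert h2 using 1
      funext x
      change (x + ψ.disp x) + φ.disp (ψ x) - x = ψ.disp x + φ.disp (ψ x)
      rw [add_assoc, add_sub_cancel_left])
    (φ.isDiffC1.comp ψ.isDiffC1)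

theorem mul_apply (φ ψ : Diff0 k d) (x : Euc d) : (φ * ψ) x = φ (ψ x) := ofMap_apply _ _ _ x

instance : One (Diff0 k d) where
  one := ofMap id
    (by
      have : (fun x : Euc d => id x - x) = 0 := by funext x; simp
      rw [this]
      exact (c0Submodule k d).zero_mem)
    ⟨contDiff_id, id, contDiff_id, fun _ => rfl, fun _ => rfl⟩

theorem one_apply (x : Euc d) : (1 : Diff0 k d) x = x := ofMap_apply _ _ _ x

instance : Inv (Diff0 k d) where
  inv φ := ofMap φ.isDiffC1.2.choose
    (inverse_mem φ.disp.2 φ.isDiffC1.2.choose_spec.1 φ.isDiffC1.2.choose_spec.2.1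
      φ.isDiffC1.2.choose_spec.2.2)
    ⟨φ.isDiffC1.2.choose_spec.1, φ, φ.isDiffC1.1, φ.isDiffC1.2.choose_spec.2.2,
      φ.isDiffC1.2.choose_spec.2.1⟩

theorem inv_apply_apply (φ : Diff0 k d) (x : Euc d) : φ⁻¹ (φ x) = x :=
  (ofMap_apply _ _ _ _).trans (φ.isDiffC1.2.choose_spec.2.1 x)

instance : Group (Diff0 k d) where
  mul_assoc a b c := by ext1 x; simp only [mul_apply]
  one_mul a := by ext1 x; simp only [mul_apply, one_apply]
  mul_one a := by ext1 x; simp only [mul_apply, one_apply]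
  inv_mul_cancel a := by ext1 x; rw [mul_apply, inv_apply_apply, one_apply]

/-- The inclusion `Diff_{C_0^{k+l}}(ℝ^d) ⊂ Diff_{C_0^k}(ℝ^d)`. -/
def incl (k l : ℕ) [NeZero k] (φ : Diff0 (k + l) d) : Diff0 k d := ⟨C0k.incl k l φ.disp, φ.2⟩

theorem incl_apply (l : ℕ) (φ : Diff0 (k + l) d) (x : Euc d) : incl k l φ x = φ x := rfl

/-- The right action of `Isom(ℝ^d)` on `Diff_{C_0^k}(ℝ^d)`:
`ρ_{(R, T)}(φ)(x) = Rᵀ φ(R x + T) - Rᵀ T`, with `Rᵀ = R⁻¹`. -/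
def rho (g : Isom d) (φ : Diff0 k d) : Diff0 k d :=
  ofMap (fun x => SO.toCLM g.rot⁻¹ (φ (SO.toCLM g.rot x + g.trans)) - SO.toCLM g.rot⁻¹ g.trans)
    (by
      have h1 := c0_comp φ.disp.2 g.contDiff_smul
        (bddDerivs_clm_add_const (SO.toCLM g.rot) g.trans)
        g.toHomeo.isClosedEmbedding.tendsto_cocompact
      have h2 := c0_clm h1 (SO.toCLM g.rot⁻¹)
      convert h2 using 1
      funext x
      change SO.toCLM g.rot⁻¹ ((SO.toCLM g.rot x + g.trans) + φ.disp (g • x))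
        - SO.toCLM g.rot⁻¹ g.trans - x = SO.toCLM g.rot⁻¹ (φ.disp (g • x))
      rw [map_add, map_add, SO.toCLM_inv_apply]
      abel)
    (by
      have hg : ∀ g : Isom d, IsDiffC1 (fun x : Euc d => g • x) := fun g =>
        ⟨g.contDiff_smul, fun x => g⁻¹ • x, g⁻¹.contDiff_smul,
          fun x => inv_smul_smul g x, fun x => smul_inv_smul g x⟩
      have := (hg g⁻¹).comp (φ.isDiffC1.comp (hg g))
      simp only [Isom.inv_smul_def] at this
      exact this)

theorem rho_apply (g : Isom d) (φ : Diff0 k d) (x : Euc d) : rho g φ x = g⁻¹ • φ (g • x) :=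
  (ofMap_apply _ _ _ _).trans (Isom.inv_smul_def g _).symm

theorem rho_one (φ : Diff0 k d) : rho 1 φ = φ := by
  ext1 x
  simp only [rho_apply, inv_one, one_smul]

theorem rho_mul (g h : Isom d) (φ : Diff0 k d) : rho (g * h) φ = rho h (rho g φ) := by
  ext1 x
  simp only [rho_apply, mul_inv_rev, mul_smul]

theorem rho_map_mul (g : Isom d) (φ ψ : Diff0 k d) : rho g (φ * ψ) = rho g φ * rho g ψ := by
  ext1 x
  simp only [rho_apply, mul_apply, smul_inv_smul]

theorem rho_map_one (g : Isom d) : rho g (1 : Diff0 k d) = 1 := by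
  ext1 x
  simp only [rho_apply, one_apply, inv_smul_smul]

end Diff0

/-! ## The group `Isom(ℝ^d) ⋉ Diff_{C_0^k}(ℝ^d)` -/

/-- The semidirect product `𝒢^k = Isom(ℝ^d) ⋉ Diff_{C_0^k}(ℝ^d)`. -/
def IsomDiff (k d : ℕ) [NeZero k] : Type := Isom d × Diff0 k d

namespace IsomDiff

variable {k d : ℕ} [NeZero k]

/-- The rigid part. -/
def isom (a : IsomDiff k d) : Isom d := a.1

/-- The diffeomorphic part. -/
def diff (a : IsomDiff k d) : Diff0 k d := a.2

@[ext] theorem ext {a b : IsomDiff k d} (h1 : a.isom = b.isom) (h2 : a.diff = b.diff) : a = b :=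
  Prod.ext h1 h2

/-- The vector space `(Skew_d × ℝ^d) × C_0^k(ℝ^d, ℝ^d)` on which `𝒢^k` is modelled; it is also the
tangent space of `𝒢^k` at the identity. -/
abbrev TangentOne (k d : ℕ) : Type := (Skew d × Euc d) × C0k k d

/-- The model of the Banach manifold `𝒢^k`. -/
abbrev model (k d : ℕ) : ModelWithCorners ℝ (TangentOne k d)
    (ModelProd (ModelProd (Skew d) (Euc d)) (C0k k d)) :=
  (Isom.model d).prod 𝓘(ℝ, C0k k d)

instance : TopologicalSpace (IsomDiff k d) := inferInstanceAs (TopologicalSpace (Isom d × Diff0 k d))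

instance : ChartedSpace (ModelProd (ModelProd (Skew d) (Euc d)) (C0k k d)) (IsomDiff k d) :=
  inferInstanceAs (ChartedSpace (ModelProd (ModelProd (Skew d) (Euc d)) (C0k k d))
    (Isom d × Diff0 k d))

instance : IsManifold (model k d) ∞ (IsomDiff k d) :=
  inferInstanceAs (IsManifold (model k d) ∞ (Isom d × Diff0 k d))

/-- `(g, φ) (g', φ') = (g g', ρ_{g'}(φ) ∘ φ')`. -/
instance : Mul (IsomDiff k d) := ⟨fun a b => (a.isom * b.isom, Diff0.rho b.isom a.diff * b.diff)⟩

instance : One (IsomDiff k d) := ⟨((1 : Isom d), (1 : Diff0 k d))⟩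

instance : Inv (IsomDiff k d) := ⟨fun a => (a.isom⁻¹, Diff0.rho a.isom⁻¹ a.diff⁻¹)⟩

theorem isom_mul (a b : IsomDiff k d) : (a * b).isom = a.isom * b.isom := rfl

theorem diff_mul (a b : IsomDiff k d) : (a * b).diff = Diff0.rho b.isom a.diff * b.diff := rfl

theorem isom_one : (1 : IsomDiff k d).isom = 1 := rfl

theorem diff_one : (1 : IsomDiff k d).diff = 1 := rfl

theorem isom_inv (a : IsomDiff k d) : (a⁻¹).isom = a.isom⁻¹ := rfl

theorem diff_inv (a : IsomDiff k d) : (a⁻¹).diff = Diff0.rho a.isom⁻¹ a.diff⁻¹ := rfl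

instance : Group (IsomDiff k d) where
  mul_assoc a b c := by
    ext1
    · simp only [isom_mul, mul_assoc]
    · simp only [isom_mul, diff_mul, Diff0.rho_mul, Diff0.rho_map_mul, mul_assoc]
  one_mul a := by
    ext1
    · simp only [isom_mul, isom_one, one_mul]
    · simp only [diff_mul, diff_one, Diff0.rho_map_one, one_mul]
  mul_one a := by
    ext1
    · simp only [isom_mul, isom_one, mul_one]
    · simp only [diff_mul, isom_one, diff_one, Diff0.rho_one, mul_one]
  inv_mul_cancel a := by
    ext1
    · simp only [isom_mul, isom_inv, inv_mul_cancel, isom_one]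
    · simp only [diff_mul, diff_inv, ← Diff0.rho_mul, inv_mul_cancel, Diff0.rho_one, diff_one]

/-- The inclusion `𝒢^{k+l} ⊂ 𝒢^k`. -/
def incl (k l : ℕ) [NeZero k] (a : IsomDiff (k + l) d) : IsomDiff k d :=
  (a.isom, Diff0.incl k l a.diff)

/-- The inclusion of the tangent spaces at the identity `T_e 𝒢^{k+l} ⊂ T_e 𝒢^k`. -/
def tangentIncl (k l : ℕ) (X : TangentOne (k + l) d) : TangentOne k d := (X.1, C0k.incl k l X.2)

end IsomDiff

/-! ## The space of immersed curves -/

/-- The two parameter spaces of curves: the interval `[0, 1]` (open curves) and the unit circle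
(closed curves). -/
inductive CurveDomain : Type
  | interval
  | circle

namespace CurveDomain

/-- The underlying set of the domain `D`. -/
def Point : CurveDomain → Type
  | interval => Icc (0 : ℝ) 1
  | circle => Circle

/-- The standard parametrization of `D`: the identity of `[0, 1]`, respectively `θ ↦ e^{iθ}`. -/
def param : (D : CurveDomain) → ℝ → D.Point
  | interval => projIcc (0 : ℝ) 1 zero_le_one
  | circle => fun θ => Circle.exp θ

/-- The set of parameters on which functions on `D` are differentiated. -/
def paramSet : CurveDomain → Set ℝ
  | interval => Icc 0 1
  | circle => univ

/-- A compact interval of parameters which covers `D`. -/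
def window : CurveDomain → Set ℝ
  | interval => Icc 0 1
  | circle => Icc (-Real.pi) Real.pi

variable (D : CurveDomain)

theorem window_subset : D.window ⊆ D.paramSet := by
  cases D
  · exact Subset.rfl
  · exact subset_univ _

theorem uniqueDiffOn : UniqueDiffOn ℝ D.paramSet := by
  cases D
  · exact uniqueDiffOn_Icc zero_lt_one
  · exact uniqueDiffOn_univ

theorem param_surjective (p : D.Point) : ∃ t ∈ D.window, D.param t = p := by
  cases D with
  | interval => exact ⟨(p : Icc (0 : ℝ) 1).1, (p : Icc (0 : ℝ) 1).2, projIcc_val zero_le_one p⟩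
  | circle =>
    let z : Circle := p
    exact ⟨Complex.arg z, ⟨(Complex.neg_pi_lt_arg _).le, Complex.arg_le_pi _⟩,
      Circle.exp_arg z⟩

instance : CompactSpace D.window := by
  cases D
  · exact isCompact_iff_compactSpace.1 isCompact_Icc
  · exact isCompact_iff_compactSpace.1 isCompact_Icc

end CurveDomain

/-- The functions `D → ℝ^d` of class `C^k`. -/
def curveSubmodule (D : CurveDomain) (k d : ℕ) : Submodule ℝ (D.Point → Euc d) where
  carrier := {q | ContDiffOn ℝ k (fun t => q (D.param t)) D.paramSet}
  add_mem' h1 h2 := ContDiffOn.add h1 h2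
  zero_mem' := contDiffOn_const
  smul_mem' c _ h := ContDiffOn.const_smul c h

/-- The space `C^k(D, ℝ^d)`. -/
def Curve (D : CurveDomain) (k d : ℕ) : Type := curveSubmodule D k d

namespace Curve

variable {D : CurveDomain} {k d : ℕ}

instance : CoeFun (Curve D k d) (fun _ => D.Point → Euc d) := ⟨fun q => q.1⟩

instance instAddCommGroup : AddCommGroup (Curve D k d) :=
  inferInstanceAs (AddCommGroup (curveSubmodule D k d))

instance instModule : Module ℝ (Curve D k d) := inferInstanceAs (Module ℝ (curveSubmodule D k d))

/-- The curve as a function of the parameter. -/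
def lift (q : Curve D k d) (t : ℝ) : Euc d := q (D.param t)

theorem contDiffOn (q : Curve D k d) : ContDiffOn ℝ k q.lift D.paramSet := q.2

/-- The family of the derivatives of order `0, …, k`. -/
def jet (D : CurveDomain) (k d : ℕ) :
    Curve D k d →ₗ[ℝ] (Fin (k + 1) → C(D.window, Euc d)) where
  toFun q i :=
    ⟨fun t => iteratedDerivWithin i q.lift D.paramSet t, by
      have hi' : ((i : ℕ) : ℕ∞ω) ≤ k := by exact_mod_cast Nat.lt_succ_iff.1 i.2
      have h := q.contDiffOn.continuousOn_iteratedDerivWithin hi' D.uniqueDiffOn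
      exact (h.mono D.window_subset).domRestrict⟩
  map_add' p q := by
    funext i
    have hi' : ((i : ℕ) : ℕ∞ω) ≤ k := by exact_mod_cast Nat.lt_succ_iff.1 i.2
    ext1 t
    have ht := D.window_subset t.2
    exact iteratedDerivWithin_add ht D.uniqueDiffOn ((p.contDiffOn.of_le hi') _ ht)
      ((q.contDiffOn.of_le hi') _ ht)
  map_smul' c q := by
    funext i
    have hi' : ((i : ℕ) : ℕ∞ω) ≤ k := by exact_mod_cast Nat.lt_succ_iff.1 i.2
    ext1 t
    have ht := D.window_subset t.2
    exact iteratedDerivWithin_const_smul ht D.uniqueDiffOn c ((q.contDiffOn.of_le hi') _ ht)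

theorem jet_injective : Function.Injective (jet D k d) := by
  intro p q h
  apply Subtype.ext
  funext x
  obtain ⟨t, ht, rfl⟩ := D.param_surjective x
  have h0 : iteratedDerivWithin 0 p.lift D.paramSet t = iteratedDerivWithin 0 q.lift D.paramSet t :=
    congrArg (fun J => J 0 ⟨t, ht⟩) h
  rwa [iteratedDerivWithin_zero, iteratedDerivWithin_zero] at h0

/-- The norm `max_{i ≤ k} sup_t ‖q^{(i)}(t)‖`. -/
instance : NormedAddCommGroup (Curve D k d) :=
  NormedAddCommGroup.induced (Curve D k d) _ (jet D k d) jet_injective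

instance : NormedSpace ℝ (Curve D k d) := NormedSpace.induced ℝ (Curve D k d) _ (jet D k d)

theorem continuous_jet : Continuous (jet D k d) := continuous_induced_dom

end Curve

/-- The set of immersions, that is of the `q ∈ C^k(D, ℝ^d)` whose derivative does not vanish. It is
open in `C^k(D, ℝ^d)`. -/
def immOpens (D : CurveDomain) (k d : ℕ) [NeZero k] : TopologicalSpace.Opens (Curve D k d) where
  carrier := {q | ∀ t ∈ D.paramSet, derivWithin q.lift D.paramSet t ≠ 0}
  is_open' := by
    have hk : 1 < k + 1 := Nat.succ_lt_succ (Nat.pos_of_ne_zero (NeZero.ne k))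
    have h1 : IsOpen {f : C(D.window, Euc d) | MapsTo f univ {0}ᶜ} :=
      ContinuousMap.isOpen_setOfPred_mapsTo isCompact_univ isOpen_compl_singleton
    have h2 : Continuous fun q : Curve D k d => Curve.jet D k d q ⟨1, hk⟩ :=
      (continuous_apply _).comp Curve.continuous_jet
    convert h1.preimage h2 using 1
    ext q
    have e : ∀ t, iteratedDerivWithin 1 q.lift D.paramSet t = derivWithin q.lift D.paramSet t :=
      fun t => by rw [iteratedDerivWithin_one]
    constructor
    · intro h t _ h0
      exact h t (D.window_subset t.2) ((e t).symm.trans h0)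
    · intro h
      have hw : ∀ t ∈ D.window, derivWithin q.lift D.paramSet t ≠ 0 := fun t ht h0 =>
        h (mem_univ ⟨t, ht⟩) ((e t).trans h0)
      cases D with
      | interval => exact hw
      | circle =>
        intro t _
        have hp : Function.Periodic (derivWithin q.lift (univ : Set ℝ)) (2 * Real.pi) := by
          intro x
          rw [derivWithin_univ, ← deriv_comp_add_const]
          congr 1
          funext y
          exact congrArg q (Circle.periodic_exp y)
        obtain ⟨s, hs, hst⟩ := hp.exists_mem_Ioc Real.two_pi_pos t (-Real.pi)
        have hs' : s ∈ Icc (-Real.pi) Real.pi := ⟨hs.1.le, by have := hs.2; linarith⟩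
        change derivWithin q.lift (univ : Set ℝ) t ≠ 0
        rw [hst]
        exact hw s hs'

/-- The manifold `Imm_{C^k}(D, ℝ^d)` of immersed curves, an open subset of `C^k(D, ℝ^d)`. -/
def Imm (D : CurveDomain) (k d : ℕ) [NeZero k] : Type := immOpens D k d

namespace Imm

variable {D : CurveDomain} {k d : ℕ} [NeZero k]

instance : TopologicalSpace (Imm D k d) := inferInstanceAs (TopologicalSpace (immOpens D k d))

instance : ChartedSpace (Curve D k d) (Imm D k d) :=
  inferInstanceAs (ChartedSpace (Curve D k d) (immOpens D k d))

instance : IsManifold 𝓘(ℝ, Curve D k d) ∞ (Imm D k d) :=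
  inferInstanceAs (IsManifold 𝓘(ℝ, Curve D k d) ∞ (immOpens D k d))

/-- The underlying `C^k` curve. -/
def curve (q : Imm D k d) : Curve D k d := q.1

instance : CoeFun (Imm D k d) (fun _ => D.Point → Euc d) := ⟨fun q => q.curve⟩

@[ext] theorem ext {p q : Imm D k d} (h : ∀ x, p x = q x) : p = q :=
  Subtype.ext (Subtype.ext (funext h))

/-- Left composition `f ∘ q` of an immersion `q` with a diffeomorphism `f` of class `C^k`. -/
def postcomp (f : Euc d → Euc d) (hf : ContDiff ℝ k f) (hd : IsDiffC1 f) (q : Imm D k d) :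
    Imm D k d :=
  ⟨⟨fun x => f (q x), hf.comp_contDiffOn q.curve.contDiffOn⟩, by
    intro t ht h0
    have hk : 1 ≤ k := Nat.one_le_iff_ne_zero.2 (NeZero.ne k)
    have hq : DifferentiableWithinAt ℝ q.curve.lift D.paramSet t :=
      (q.curve.contDiffOn.differentiableOn (by exact_mod_cast NeZero.ne k)) t ht
    obtain ⟨hf1, g, hg, hl, hr⟩ := hd
    have h1 : derivWithin (f ∘ q.curve.lift) D.paramSet t
        = fderiv ℝ f (q.curve.lift t) (derivWithin q.curve.lift D.paramSet t) :=
      ((hf1.differentiable one_ne_zero _).hasFDerivAt.comp_hasDerivWithinAt t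
        hq.hasDerivWithinAt).derivWithin (D.uniqueDiffOn t ht)
    have h2 : fderivEquiv hf1 hg hl hr (q.curve.lift t)
        (derivWithin q.curve.lift D.paramSet t) = 0 := h1.symm.trans h0
    exact q.2 t ht ((ContinuousLinearEquiv.map_eq_zero_iff _).1 h2)⟩

theorem postcomp_apply (f : Euc d → Euc d) (hf : ContDiff ℝ k f) (hd : IsDiffC1 f) (q : Imm D k d)
    (x : D.Point) : postcomp f hf hd q x = f (q x) := rfl

/-- The action `(φ, q) ↦ φ ∘ q` of `Diff_{C_0^k}(ℝ^d)` on immersions. -/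
instance : MulAction (Diff0 k d) (Imm D k d) where
  smul φ q := postcomp φ φ.contDiff φ.isDiffC1 q
  one_smul q := by
    ext1 x
    exact Diff0.one_apply (q x)
  mul_smul φ ψ q := by
    ext1 x
    exact Diff0.mul_apply φ ψ (q x)

theorem diff_smul_apply (φ : Diff0 k d) (q : Imm D k d) (x : D.Point) : (φ • q) x = φ (q x) := rfl

/-- The action `(R, T) · q = R q + T` of `Isom(ℝ^d)` on immersions. -/
instance : MulAction (Isom d) (Imm D k d) where
  smul g q := postcomp (fun x => SO.toCLM g.rot x + g.trans) g.contDiff_smul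
    ⟨g.contDiff_smul, fun x => g⁻¹ • x, g⁻¹.contDiff_smul,
      fun x => inv_smul_smul g x, fun x => smul_inv_smul g x⟩ q
  one_smul q := by
    ext1 x
    exact one_smul (Isom d) (q x)
  mul_smul g h q := by
    ext1 x
    exact mul_smul g h (q x)

theorem isom_smul_apply (g : Isom d) (q : Imm D k d) (x : D.Point) : (g • q) x = g • q x := rfl

theorem diff_smul_isom_smul (φ : Diff0 k d) (g : Isom d) (q : Imm D k d) :
    φ • g • q = g • Diff0.rho g φ • q := by
  ext1 x
  rw [isom_smul_apply, diff_smul_apply, diff_smul_apply, isom_smul_apply, Diff0.rho_apply,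
    smul_inv_smul]

/-- The action `(g, φ) · (h, q) = (g h, g · (φ · q))` of `𝒢^k = Isom(ℝ^d) ⋉ Diff_{C_0^k}(ℝ^d)` on
`Isom(ℝ^d) × Imm_{C^k}(D, ℝ^d)`. -/
instance : MulAction (IsomDiff k d) (Isom d × Imm D k d) where
  smul a p := (a.isom * p.1, a.isom • a.diff • p.2)
  one_smul p := by
    change ((1 : Isom d) * p.1, (1 : Isom d) • (1 : Diff0 k d) • p.2) = p
    rw [one_mul, one_smul, one_smul]
  mul_smul a b p := by
    change ((a.isom * b.isom) * p.1, (a.isom * b.isom) • (Diff0.rho b.isom a.diff * b.diff) • p.2)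
      = (a.isom * (b.isom * p.1), a.isom • a.diff • b.isom • b.diff • p.2)
    rw [diff_smul_isom_smul, mul_assoc, mul_smul, mul_smul]

end Imm

/-! ## Shape spaces -/

section ShapeSpace

variable (k d : ℕ) [NeZero k]
  {F : Type*} [NormedAddCommGroup F] [NormedSpace ℝ F] {H : Type*} [TopologicalSpace H]
  (I : ModelWithCorners ℝ F H) {Q : Type*} [TopologicalSpace Q] [ChartedSpace H Q]
  [MulAction (IsomDiff k d) Q]

/-- The infinitesimal action at `q`: the differential at the identity of `a ↦ a · q`. -/
def infinitesimalAction (q : Q) :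
    IsomDiff.TangentOne k d →L[ℝ] TangentSpace I ((1 : IsomDiff k d) • q) :=
  mfderiv (IsomDiff.model k d) I (fun a : IsomDiff k d => a • q) 1

variable (Q)

/-- The action of the groups `𝒢^{k+l} = Isom(ℝ^d) ⋉ Diff_{C_0^{k+l}}(ℝ^d)`, `l ≥ 0`, makes the
manifold `Q` a shape space: the action of `𝒢^k` is continuous and smooth in the group variable, and,
for `l > 0`, the action of `𝒢^{k+l}` and the infinitesimal action of its tangent space at the
identity are of class `C^l`. -/
structure IsShapeSpace [IsManifold I ∞ Q] : Prop where
  continuous_action : Continuous fun p : IsomDiff k d × Q => p.1 • p.2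
  contMDiff_orbit : ∀ q : Q, ContMDiff (IsomDiff.model k d) I ∞ fun a : IsomDiff k d => a • q
  contMDiff_action : ∀ l : ℕ, 0 < l →
    ContMDiff ((IsomDiff.model (k + l) d).prod I) I l
      fun p : IsomDiff (k + l) d × Q => IsomDiff.incl k l p.1 • p.2
  contMDiff_infinitesimalAction : ∀ l : ℕ, 0 < l →
    ContMDiff (𝓘(ℝ, IsomDiff.TangentOne (k + l) d).prod I) I.tangent l
      fun p : IsomDiff.TangentOne (k + l) d × Q =>
        (⟨(1 : IsomDiff k d) • p.2,
          infinitesimalAction k d I p.2 (IsomDiff.tangentIncl k l p.1)⟩ : TangentBundle I Q)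

end ShapeSpace

end

/-! In the coordinates given by the displacement `u = φ - id` and by the underlying curve, `φ · q`
reads `q + u ∘ q` and `(R, T) · q` reads `R q + T`. The latter is bilinear in `(R, q)` plus linear
in `T`, hence smooth, because smoothness on `SO_d` can be tested on matrices (`SO.contMDiff_coe`,
`SO.contMDiff_of_coe`). The action of `𝒢^k` is therefore the smooth map `Imm.rigid` applied to `(g,
(h, φ · q))`, and regularity can only be lost in the composition `u ∘ q`.

The heart is `Curve.contDiff_comp`: composition is `C^l` from `C_0^{k+l} × C^k(D)` to `C^k(D)`. For
`k = 0` one argues by induction on `l`. The derivative at `(u, q)` is `(v, p) ↦ v ∘ q + Du(q) p`;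
its second term consists of compositions with the `∂_j u`, one order lower. The first term has to be
regular in `q` as an operator in `v`, for the operator norm; this is `Curve.contDiff_compOp`, where
derivatives of the fields pay for regularity in `q`, uniformly over the unit ball of fields. For
larger `k`, a curve is recovered from its initial value and its derivative by the bounded operator
`Curve.primitive`, and `(u ∘ q)' = ∑ q'_j (∂_j u ∘ q)` falls under the preceding order.

The case `l = 0` gives continuity of the action. For fixed `q`, composition is a bounded linear
operator in `u`, so orbit maps are smooth with no loss. The infinitesimal action is the tangent map
of `Imm.rigid` evaluated at `(X_g, (0, X_u ∘ q))`, so its regularity again follows from that of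
composition. The compatibility condition is the cancellation of `g` against `g⁻¹` at each point. -/

noncomputable section

/-! ### Vector fields: bounded operators on `C_0^n` and Taylor estimates -/

namespace C0k

variable {k m n d : ℕ}

theorem norm_le {u : C0k k d} {C : ℝ} (hC : 0 ≤ C)
    (h : ∀ i ≤ k, ∀ x, ‖iteratedFDeriv ℝ i u x‖ ≤ C) : ‖u‖ ≤ C :=
  (pi_norm_le_iff_of_nonneg (x := jet k d u) hC).2 fun i =>
    (BoundedContinuousFunction.norm_le (f := (jet k d u i).toBCF) hC).2
      fun x => h i (Nat.lt_succ_iff.1 i.2) x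

/-- The inclusion `C_0^n ⊂ C_0^m` for `m ≤ n`, as a continuous linear map. -/
def restrict (h : m ≤ n) : C0k n d →L[ℝ] C0k m d :=
  LinearMap.mkContinuous
    { toFun := fun u => ⟨u.1, u.2.1.of_le (by exact_mod_cast h), fun i hi => u.2.2 i (hi.trans h)⟩
      map_add' := fun _ _ => rfl
      map_smul' := fun _ _ => rfl } 1 fun u => by
    rw [one_mul]
    exact norm_le (norm_nonneg u) fun i hi x => u.norm_iteratedFDeriv_le (hi.trans h) x

theorem differentiable (u : C0k n d) (h : 1 ≤ n) : Differentiable ℝ u :=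
  u.contDiff.differentiable (by exact_mod_cast (by omega : n ≠ 0))

theorem norm_fderiv_le (u : C0k n d) (h : 1 ≤ n) (x : Euc d) : ‖fderiv ℝ u x‖ ≤ ‖u‖ := by
  rw [← norm_iteratedFDeriv_one]
  exact u.norm_iteratedFDeriv_le h x

/-- The `j`-th vector of the standard basis of `ℝ^d`. -/
abbrev basisVec (d : ℕ) (j : Fin d) : Euc d := EuclideanSpace.single j 1

/-- Evaluation at a unit vector has norm at most one, and the derivatives of order `i` of `Du` are
those of order `i + 1` of `u`. Both the decay and the bound needed for `pderiv` come from this. -/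
theorem norm_iteratedFDeriv_pderiv_le {u : Euc d → Euc d} (h : m + 1 ≤ n) (hu : ContDiff ℝ n u)
    (j : Fin d) {i : ℕ} (hi : i ≤ m) (x : Euc d) :
    ‖iteratedFDeriv ℝ i (fun x => fderiv ℝ u x (basisVec d j)) x‖
      ≤ ‖iteratedFDeriv ℝ (i + 1) u x‖ := by
  have hf : ContDiff ℝ i (fderiv ℝ u) :=
    hu.fderiv_right (by exact_mod_cast (by omega : i + 1 ≤ n))
  have := (ContinuousLinearMap.apply ℝ (Euc d) (basisVec d j)).norm_iteratedFDeriv_comp_left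
    (hf.contDiffAt (x := x)) le_rfl
  refine this.trans ?_
  rw [norm_iteratedFDeriv_fderiv]
  refine mul_le_of_le_one_left (norm_nonneg _) ?_
  refine ContinuousLinearMap.opNorm_le_bound _ zero_le_one fun L => ?_
  have := L.le_opNorm (basisVec d j)
  simpa using this

/-- The partial derivative `∂_j : C_0^n → C_0^m` for `m < n`, as a continuous linear map. -/
def pderiv (h : m + 1 ≤ n) (j : Fin d) : C0k n d →L[ℝ] C0k m d :=
  LinearMap.mkContinuous
    { toFun := fun u => ⟨fun x => fderiv ℝ u x (basisVec d j),
        (u.contDiff.fderiv_right (by exact_mod_cast h)).clm_apply contDiff_const, fun i hi => by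
          refine squeeze_zero_norm
            (fun x => norm_iteratedFDeriv_pderiv_le h u.contDiff j hi x) ?_
          simpa using (u.tendsto (i := i + 1) (by omega)).norm⟩
      map_add' := fun u v => by
        apply Subtype.ext
        funext x
        have hd := (u.differentiable (by omega) x).hasFDerivAt.add
          (v.differentiable (by omega) x).hasFDerivAt
        exact congrArg (fun L => L (basisVec d j)) hd.fderiv
      map_smul' := fun c u => by
        apply Subtype.ext
        funext x
        have hd := (u.differentiable (by omega) x).hasFDerivAt.const_smul c
        exact congrArg (fun L => L (basisVec d j)) hd.fderiv } 1 fun u => by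
    rw [one_mul]
    exact norm_le (norm_nonneg u) fun i hi x =>
      (norm_iteratedFDeriv_pderiv_le h u.contDiff j hi x).trans
        (u.norm_iteratedFDeriv_le (by omega) x)

theorem pderiv_apply (h : m + 1 ≤ n) (j : Fin d) (u : C0k n d) (x : Euc d) :
    pderiv h j u x = fderiv ℝ u x (basisVec d j) := rfl

/-- Writing `Du · v` with `ℝ^d`-valued fields only keeps the later inductions inside the spaces
`C_0^m(ℝ^d, ℝ^d)` and `C^k(D, ℝ^d)`. -/
theorem sum_coord_smul_pderiv (h : m + 1 ≤ n) (u : C0k n d) (x v : Euc d) :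
    ∑ j, v j • pderiv h j u x = fderiv ℝ u x v := by
  have hv : v = ∑ j, v j • basisVec d j := by
    ext i
    simp [Finset.sum_apply, Pi.single_apply]
  conv_rhs => rw [hv, map_sum]
  exact Finset.sum_congr rfl fun j _ => by rw [map_smul, pderiv_apply]

theorem norm_sub_le (u : C0k n d) (h : 1 ≤ n) (x y : Euc d) : ‖u x - u y‖ ≤ ‖u‖ * ‖x - y‖ :=
  Convex.norm_image_sub_le_of_norm_fderiv_le (fun z _ => u.differentiable h z)
    (fun z _ => u.norm_fderiv_le h z) convex_univ (mem_univ y) (mem_univ x)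

/-- Continuity together with decay at infinity. This is what remains at `n = 0`, where there is no
Lipschitz bound. -/
theorem uniformContinuous (u : C0k n d) : UniformContinuous u := by
  refine u.contDiff.continuous.uniformContinuous_of_tendsto_cocompact (x := 0) ?_
  have := (u.tendsto (Nat.zero_le n)).norm
  simp only [norm_iteratedFDeriv_zero, norm_zero] at this
  exact tendsto_zero_iff_norm_tendsto_zero.2 this

/-- Stands in for a Lipschitz bound on `Du` when `u` is only known to be `C^1`. -/
theorem uniformContinuous_fderiv (u : C0k n d) (h : 1 ≤ n) : UniformContinuous (fderiv ℝ u) := by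
  refine Continuous.uniformContinuous_of_tendsto_cocompact (x := 0)
    (u.contDiff.continuous_fderiv (by exact_mod_cast (by omega : n ≠ 0))) ?_
  have := (u.tendsto h).norm
  simp only [norm_iteratedFDeriv_one, norm_zero] at this
  exact tendsto_zero_iff_norm_tendsto_zero.2 this

/-- The second derivative is bounded by the norm. The bound is linear in `‖u‖`, which makes the
Taylor estimate uniform over the unit ball of fields. -/
theorem norm_fderiv_sub_le (u : C0k n d) (h : 2 ≤ n) (x y : Euc d) :
    ‖fderiv ℝ u x - fderiv ℝ u y‖ ≤ ‖u‖ * ‖x - y‖ := by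
  have hf : ContDiff ℝ 1 (fderiv ℝ u) :=
    u.contDiff.fderiv_right (by exact_mod_cast (by omega : 1 + 1 ≤ n))
  refine Convex.norm_image_sub_le_of_norm_fderiv_le
    (fun z _ => hf.differentiable one_ne_zero z) (fun z _ => ?_) convex_univ (mem_univ y)
    (mem_univ x)
  rw [← norm_iteratedFDeriv_one, norm_iteratedFDeriv_fderiv]
  exact u.norm_iteratedFDeriv_le h z

/-- First order Taylor estimate from a bound on the oscillation of the derivative. -/
theorem norm_taylor_le (u : C0k n d) (h : 1 ≤ n) {x v : Euc d} {C : ℝ}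
    (hC : ∀ z, ‖z - x‖ ≤ ‖v‖ → ‖fderiv ℝ u z - fderiv ℝ u x‖ ≤ C) :
    ‖u (x + v) - u x - fderiv ℝ u x v‖ ≤ C * ‖v‖ := by
  have hx : x ∈ Metric.closedBall x ‖v‖ := Metric.mem_closedBall_self (norm_nonneg v)
  have hv : x + v ∈ Metric.closedBall x ‖v‖ := by simp
  have := (convex_closedBall x ‖v‖).norm_image_sub_le_of_norm_fderiv_le' (𝕜 := ℝ)
    (fun z _ => u.differentiable h z)
    (fun z hz => hC z (by rwa [mem_closedBall_iff_norm] at hz)) hx hv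
  simpa using this

end C0k

/-! ### Parameters of points of `D` -/

namespace CurveDomain

theorem param_eq_iff_circle (s t : ℝ) : circle.param s = circle.param t ↔
    ∃ m : ℤ, s = t + m * (2 * Real.pi) := Circle.exp_eq_exp

/-- A parameter of a point of `D`. -/
def parameter (D : CurveDomain) (x : D.Point) : ℝ := (D.param_surjective x).choose

theorem parameter_mem_window {D : CurveDomain} (x : D.Point) : D.parameter x ∈ D.window :=
  (D.param_surjective x).choose_spec.1

theorem param_parameter {D : CurveDomain} (x : D.Point) : D.param (D.parameter x) = x :=
  (D.param_surjective x).choose_spec.2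

/-- The constant `4` dominates both `1` and `π`; it only serves as a common bound for the length of
integration. -/
theorem abs_le_of_mem_window {D : CurveDomain} {t : ℝ} (ht : t ∈ D.window) : |t| ≤ 4 := by
  cases D with
  | interval => exact abs_le.2 ⟨by linarith [ht.1], by linarith [ht.2]⟩
  | circle => exact
      abs_le.2 ⟨by linarith [ht.1, Real.pi_lt_four], by linarith [ht.2, Real.pi_lt_four]⟩

theorem zero_mem_window (D : CurveDomain) : (0 : ℝ) ∈ D.window := by
  cases D with
  | interval => exact ⟨le_rfl, zero_le_one⟩
  | circle => exact ⟨by linarith [Real.pi_pos], Real.pi_pos.le⟩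

theorem convex_paramSet (D : CurveDomain) : Convex ℝ D.paramSet := by
  cases D
  · exact convex_Icc 0 1
  · exact convex_univ

end CurveDomain

/-! ### Norms and linear operators on `C^k(D, ℝ^d)` -/

namespace Curve

variable {D : CurveDomain} {k m n d : ℕ}

theorem ext {p q : Curve D k d} (h : ∀ x, p x = q x) : p = q := Subtype.ext (funext h)

theorem norm_iteratedDerivWithin_le (q : Curve D k d) {i : ℕ} (hi : i ≤ k) {t : ℝ}
    (ht : t ∈ D.window) : ‖iteratedDerivWithin i q.lift D.paramSet t‖ ≤ ‖q‖ :=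
  ((jet D k d q ⟨i, Nat.lt_succ_iff.2 hi⟩).norm_coe_le_norm ⟨t, ht⟩).trans
    (norm_le_pi_norm (jet D k d q) ⟨i, Nat.lt_succ_iff.2 hi⟩)

theorem norm_le {q : Curve D k d} {C : ℝ} (hC : 0 ≤ C)
    (h : ∀ i ≤ k, ∀ t ∈ D.window, ‖iteratedDerivWithin i q.lift D.paramSet t‖ ≤ C) : ‖q‖ ≤ C :=
  (pi_norm_le_iff_of_nonneg (x := jet D k d q) hC).2 fun i =>
    (ContinuousMap.norm_le (jet D k d q i) hC).2 fun t => h i (Nat.lt_succ_iff.1 i.2) t t.2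

theorem norm_apply_le (q : Curve D k d) (x : D.Point) : ‖q x‖ ≤ ‖q‖ := by
  obtain ⟨t, ht, rfl⟩ := D.param_surjective x
  have h := q.norm_iteratedDerivWithin_le (Nat.zero_le k) ht
  rwa [iteratedDerivWithin_zero] at h

theorem norm_le_zero {q : Curve D 0 d} {C : ℝ} (hC : 0 ≤ C) (h : ∀ x, ‖q x‖ ≤ C) : ‖q‖ ≤ C :=
  norm_le hC fun i hi t _ => by
    obtain rfl : i = 0 := Nat.le_zero.1 hi
    rw [iteratedDerivWithin_zero]
    exact h _

/-- Derivatives of order `i + 1` of `q` are those of order `i` of `q'`, so the norm is controlled by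
the values and the norm of the derivative. This bounds `primitive`. -/
theorem norm_le_succ {q : Curve D (k + 1) d} {C : ℝ} (hC : 0 ≤ C) (p : Curve D k d)
    (hp : EqOn (derivWithin q.lift D.paramSet) p.lift D.paramSet) (h0 : ∀ x, ‖q x‖ ≤ C)
    (h1 : ‖p‖ ≤ C) : ‖q‖ ≤ C :=
  norm_le hC fun i hi t ht => by
    rcases i with _ | i
    · rw [iteratedDerivWithin_zero]
      exact h0 _
    · rw [iteratedDerivWithin_succ', iteratedDerivWithin_congr hp (D.window_subset ht)]
      exact (p.norm_iteratedDerivWithin_le (by omega) ht).trans h1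

theorem sum_apply {ι : Type*} (s : Finset ι) (q : ι → Curve D k d) (x : D.Point) :
    (∑ i ∈ s, q i) x = ∑ i ∈ s, q i x := by
  let ev : Curve D k d →+ Euc d := ⟨⟨fun q => q x, rfl⟩, fun _ _ => rfl⟩
  exact map_sum ev q s

/-- The inclusion `C^n ⊂ C^m` for `m ≤ n`, as a continuous linear map. -/
def restrict (h : m ≤ n) : Curve D n d →L[ℝ] Curve D m d :=
  LinearMap.mkContinuous
    { toFun := fun q => ⟨q.1, q.contDiffOn.of_le (by exact_mod_cast h)⟩
      map_add' := fun _ _ => rfl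
      map_smul' := fun _ _ => rfl } 1 fun q => by
    rw [one_mul]
    exact norm_le (norm_nonneg q) fun i hi t ht => q.norm_iteratedDerivWithin_le (hi.trans h) ht

/-- Evaluation at a point. -/
def eval (x : D.Point) : Curve D k d →L[ℝ] Euc d :=
  LinearMap.mkContinuous
    { toFun := fun q => q x
      map_add' := fun _ _ => rfl
      map_smul' := fun _ _ => rfl } 1 fun q => by
    rw [one_mul]
    exact q.norm_apply_le x

/-- Constant curves. -/
def const (D : CurveDomain) (k d : ℕ) : Euc d →L[ℝ] Curve D k d :=
  LinearMap.mkContinuous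
    { toFun := fun v => ⟨fun _ => v, contDiffOn_const⟩
      map_add' := fun _ _ => rfl
      map_smul' := fun _ _ => rfl } 1 fun v => by
    rw [one_mul]
    refine norm_le (norm_nonneg v) fun i _ t _ => ?_
    change ‖iteratedDerivWithin i (fun _ => v) D.paramSet t‖ ≤ ‖v‖
    rw [iteratedDerivWithin_const]
    split_ifs <;> simp

/-- The curve with a prescribed expression in the parameter. -/
def ofParam (γ : ℝ → Euc d) (hγ : ContDiffOn ℝ k γ D.paramSet)
    (hp : ∀ s ∈ D.paramSet, ∀ t ∈ D.paramSet, D.param s = D.param t → γ s = γ t) : Curve D k d :=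
  ⟨fun x => γ (D.parameter x), hγ.congr fun _ ht =>
    hp _ (D.window_subset (CurveDomain.parameter_mem_window _)) _ ht
      (CurveDomain.param_parameter _)⟩

theorem ofParam_lift {γ : ℝ → Euc d} (hγ : ContDiffOn ℝ k γ D.paramSet)
    (hp : ∀ s ∈ D.paramSet, ∀ t ∈ D.paramSet, D.param s = D.param t → γ s = γ t) :
    EqOn (ofParam γ hγ hp).lift γ D.paramSet := fun _ ht =>
  hp _ (D.window_subset (CurveDomain.parameter_mem_window _)) _ ht (CurveDomain.param_parameter _)

theorem ext_lift {p q : Curve D k d} (h : EqOn p.lift q.lift D.paramSet) : p = q :=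
  ext fun x => by
    obtain ⟨t, ht, rfl⟩ := D.param_surjective x
    exact h (D.window_subset ht)

theorem lift_periodic (q : Curve CurveDomain.circle k d) :
    Function.Periodic q.lift (2 * Real.pi) := fun t =>
  congrArg q (Circle.periodic_exp t)

/-- The derivative descends from the parameter to `D`: on the circle the lift is `2π`-periodic,
hence so is its derivative; on the interval the parameter is unique. -/
theorem derivWithin_lift_eq (q : Curve D k d) (s : ℝ) (hs : s ∈ D.paramSet) (t : ℝ)
    (ht : t ∈ D.paramSet) (h : D.param s = D.param t) :
    derivWithin q.lift D.paramSet s = derivWithin q.lift D.paramSet t := by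
  cases D with
  | interval =>
    have : s = t := by
      have h' := congrArg (fun z : Icc (0 : ℝ) 1 => (z : ℝ)) h
      simpa [CurveDomain.param, projIcc_of_mem zero_le_one hs, projIcc_of_mem zero_le_one ht]
        using h'
    rw [this]
  | circle =>
    obtain ⟨m, rfl⟩ := (CurveDomain.param_eq_iff_circle s t).1 h
    change derivWithin q.lift univ _ = derivWithin q.lift univ _
    rw [derivWithin_univ, ← deriv_comp_add_const]
    congr 1
    funext y
    exact (q.lift_periodic.int_mul m) y

theorem differentiableOn_lift (q : Curve D n d) (h : 1 ≤ n) :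
    DifferentiableOn ℝ q.lift D.paramSet :=
  q.contDiffOn.differentiableOn (by exact_mod_cast (by omega : n ≠ 0))

/-- The derivative of a curve with respect to the parameter. -/
def derivFun (h : m + 1 ≤ n) (q : Curve D n d) : Curve D m d :=
  ofParam (derivWithin q.lift D.paramSet)
    (q.contDiffOn.derivWithin D.uniqueDiffOn (by exact_mod_cast h)) q.derivWithin_lift_eq

theorem derivFun_lift (h : m + 1 ≤ n) (q : Curve D n d) :
    EqOn (derivFun h q).lift (derivWithin q.lift D.paramSet) D.paramSet := ofParam_lift _ _

/-- The derivative of curves, as a continuous linear map. -/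
def deriv (h : m + 1 ≤ n) : Curve D n d →L[ℝ] Curve D m d :=
  LinearMap.mkContinuous
    { toFun := derivFun h
      map_add' := fun p q => ext_lift fun t ht => by
        change _ = (derivFun h p).lift t + (derivFun h q).lift t
        rw [derivFun_lift h _ ht, derivFun_lift h _ ht, derivFun_lift h _ ht]
        exact derivWithin_add (p.differentiableOn_lift (by omega) t ht)
          (q.differentiableOn_lift (by omega) t ht)
      map_smul' := fun c q => ext_lift fun t ht => by
        change _ = c • (derivFun h q).lift t
        rw [derivFun_lift h _ ht, derivFun_lift h _ ht]
        exact derivWithin_const_smul c (q.differentiableOn_lift (by omega) t ht) } 1 fun q => by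
    rw [one_mul]
    refine norm_le (norm_nonneg q) fun i hi t ht => ?_
    change ‖iteratedDerivWithin i (derivFun h q).lift D.paramSet t‖ ≤ ‖q‖
    rw [iteratedDerivWithin_congr (derivFun_lift h q) (D.window_subset ht),
      ← iteratedDerivWithin_succ']
    exact q.norm_iteratedDerivWithin_le (by omega) ht

theorem deriv_lift (h : m + 1 ≤ n) (q : Curve D n d) :
    EqOn (deriv h q).lift (derivWithin q.lift D.paramSet) D.paramSet := derivFun_lift h q

/-- The pointwise action of a linear map on curves. -/
def postcompL : (Euc d →L[ℝ] Euc d) →L[ℝ] Curve D k d →L[ℝ] Curve D k d :=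
  LinearMap.mkContinuous₂
    (LinearMap.mk₂ ℝ (fun (L : Euc d →L[ℝ] Euc d) (q : Curve D k d) =>
        (⟨fun x => L (q x), L.contDiff.comp_contDiffOn q.contDiffOn⟩ : Curve D k d))
      (fun _ _ _ => rfl) (fun _ _ _ => rfl)
      (fun L p q => ext fun x => L.map_add (p x) (q x))
      (fun c L q => ext fun x => L.map_smul c (q x))) 1 fun L q => by
    rw [one_mul]
    refine norm_le (by positivity) fun i hi t ht => ?_
    have hi' : (i : ℕ∞ω) ≤ k := by exact_mod_cast hi
    have h := L.norm_iteratedFDerivWithin_comp_left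
      (q.contDiffOn.of_le hi' t (D.window_subset ht)) D.uniqueDiffOn (D.window_subset ht) le_rfl
    rw [norm_iteratedFDerivWithin_eq_norm_iteratedDerivWithin,
      norm_iteratedFDerivWithin_eq_norm_iteratedDerivWithin] at h
    exact h.trans (mul_le_mul_of_nonneg_left (q.norm_iteratedDerivWithin_le hi ht) (norm_nonneg L))

/-- The pointwise application of a bilinear map to curves. -/
def bilin (B : Euc d →L[ℝ] Euc d →L[ℝ] Euc d) : Curve D k d →L[ℝ] Curve D k d →L[ℝ] Curve D k d :=
  LinearMap.mkContinuous₂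
    (LinearMap.mk₂ ℝ (fun (p q : Curve D k d) =>
        (⟨fun x => B (p x) (q x), B.isBoundedBilinearMap.contDiff.comp_contDiffOn
          (p.contDiffOn.prodMk q.contDiffOn)⟩ : Curve D k d))
      (fun p p' q => ext fun x => by
        change B (p x + p' x) (q x) = B (p x) (q x) + B (p' x) (q x)
        rw [map_add, _root_.add_apply])
      (fun c p q => ext fun x => by
        change B (c • p x) (q x) = c • B (p x) (q x)
        rw [map_smul, _root_.smul_apply])
      (fun p q q' => ext fun x => (B (p x)).map_add (q x) (q' x))
      (fun c p q => ext fun x => (B (p x)).map_smul c (q x)))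
    -- The Leibniz formula at order `i` gives the sum of the binomial coefficients of `i`; summing
    -- over all `i ≤ k` gives one constant for every order.
    (‖B‖ * ∑ i ∈ Finset.range (k + 1), ∑ j ∈ Finset.range (i + 1), (i.choose j : ℝ)) fun p q => by
    have hS : ∀ i ∈ Finset.range (k + 1), (0 : ℝ) ≤ ∑ j ∈ Finset.range (i + 1), (i.choose j : ℝ) :=
      fun i _ => Finset.sum_nonneg fun j _ => by positivity
    have hS' := Finset.sum_nonneg hS
    refine norm_le (by positivity) fun i hi t ht => ?_
    have hi' : (i : ℕ∞ω) ≤ k := by exact_mod_cast hi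
    have h := B.norm_iteratedFDerivWithin_le_of_bilinear p.contDiffOn q.contDiffOn
      D.uniqueDiffOn (D.window_subset ht) hi'
    simp only [norm_iteratedFDerivWithin_eq_norm_iteratedDerivWithin] at h
    refine h.trans ?_
    rw [mul_assoc, mul_assoc]
    refine mul_le_mul_of_nonneg_left ?_ (norm_nonneg B)
    refine le_trans ?_ (mul_le_mul_of_nonneg_right
      (Finset.single_le_sum hS (Finset.mem_range.2 (Nat.lt_succ_iff.2 hi))) (by positivity))
    rw [Finset.sum_mul]
    refine Finset.sum_le_sum fun j hj => ?_
    have hj' := Finset.mem_range.1 hj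
    rw [mul_assoc]
    refine mul_le_mul_of_nonneg_left ?_ (by positivity)
    exact mul_le_mul (p.norm_iteratedDerivWithin_le (by omega) ht)
      (q.norm_iteratedDerivWithin_le (by omega) ht) (norm_nonneg _) (norm_nonneg _)

/-- Multiplication of a curve `p` by the `j`-th coordinate of a curve `q`. -/
def mulCoord (j : Fin d) : Curve D k d →L[ℝ] Curve D k d →L[ℝ] Curve D k d :=
  bilin ((ContinuousLinearMap.lsmul ℝ ℝ : ℝ →L[ℝ] Euc d →L[ℝ] Euc d).comp
    (EuclideanSpace.proj j : Euc d →L[ℝ] ℝ)).flip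

/-! ### Integration and reconstruction of curves from their derivatives -/

theorem continuous_lift (q : Curve D k d) : Continuous q.lift := by
  have h := q.contDiffOn.continuousOn
  cases D with
  | interval =>
    -- Outside `[0, 1]` the lift is constant, being defined through the projection onto the
    -- interval. It is thus continuous on all of `ℝ`, and its integral is differentiable on both
    -- sides even at the endpoints.
    have h2 := h.comp_continuous (f := fun t : ℝ => (projIcc (0 : ℝ) 1 zero_le_one t : ℝ))
      (continuous_subtype_val.comp continuous_projIcc) (fun t => (projIcc (0 : ℝ) 1 zero_le_one t).2)
    have e : q.lift ∘ (fun t : ℝ => (projIcc (0 : ℝ) 1 zero_le_one t : ℝ)) = q.lift :=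
      funext fun t => congrArg q (projIcc_val zero_le_one _)
    rwa [e] at h2
  | circle => exact continuousOn_univ.1 h

/-- The integral of a curve over a parameter interval. -/
def integral (a b : ℝ) : Curve D k d →L[ℝ] Euc d :=
  LinearMap.mkContinuous
    { toFun := fun q => ∫ s in a..b, q.lift s
      map_add' := fun p q => intervalIntegral.integral_add
        (p.continuous_lift.intervalIntegrable _ _) (q.continuous_lift.intervalIntegrable _ _)
      map_smul' := fun c q => intervalIntegral.integral_smul c q.lift } |b - a| fun q => by
    rw [mul_comm]
    exact intervalIntegral.norm_integral_le_of_norm_le_const fun s _ => q.norm_apply_le _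

theorem integral_apply (a b : ℝ) (q : Curve D k d) : integral a b q = ∫ s in a..b, q.lift s := rfl

/-- The projection of `C^k(D, ℝ^d)` onto the curves which have a primitive on `D`: the identity on
the interval, and the subtraction of the mean value on the circle. -/
def exactPart : (D : CurveDomain) → (k d : ℕ) → Curve D k d →L[ℝ] Curve D k d
  | .interval, _, _ => ContinuousLinearMap.id ℝ _
  | .circle, k, d => ContinuousLinearMap.id ℝ _ -
      (2 * Real.pi)⁻¹ • (const .circle k d).comp (integral 0 (2 * Real.pi))

theorem exactPart_circle (q : Curve .circle k d) : exactPart .circle k d q =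
    q - (2 * Real.pi)⁻¹ • const .circle k d (integral 0 (2 * Real.pi) q) := rfl

theorem integral_exactPart_circle (q : Curve .circle k d) :
    integral 0 (2 * Real.pi) (exactPart .circle k d q) = 0 := by
  rw [exactPart_circle, map_sub, map_smul, sub_eq_zero]
  generalize integral 0 (2 * Real.pi) q = v
  have : integral 0 (2 * Real.pi) (const .circle k d v) = (2 * Real.pi) • v := by
    change ∫ _ in (0 : ℝ)..(2 * Real.pi), v = _
    rw [intervalIntegral.integral_const, sub_zero]
  rw [this, smul_smul, inv_mul_cancel₀ (by positivity), one_smul]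

theorem hasDerivAt_integral_lift (q : Curve D k d) (v : Euc d) (t : ℝ) :
    HasDerivAt (fun t => v + ∫ s in (0 : ℝ)..t, q.lift s) (q.lift t) t :=
  (intervalIntegral.integral_hasDerivAt_right (q.continuous_lift.intervalIntegrable _ _)
    (q.continuous_lift.stronglyMeasurableAtFilter _ _) q.continuous_lift.continuousAt).const_add v

theorem derivWithin_integral_lift (q : Curve D k d) (v : Euc d) :
    EqOn (derivWithin (fun t => v + ∫ s in (0 : ℝ)..t, q.lift s) D.paramSet) q.lift D.paramSet :=
  fun t ht => (q.hasDerivAt_integral_lift v t).hasDerivWithinAt.derivWithin (D.uniqueDiffOn t ht)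

theorem contDiffOn_integral_lift (q : Curve D k d) (v : Euc d) :
    ContDiffOn ℝ (k + 1 : ℕ) (fun t => v + ∫ s in (0 : ℝ)..t, q.lift s) D.paramSet := by
  rw [Nat.cast_add, Nat.cast_one, contDiffOn_succ_iff_derivWithin D.uniqueDiffOn]
  refine ⟨fun t _ => (q.hasDerivAt_integral_lift v t).differentiableAt.differentiableWithinAt,
    fun h => ?_, q.contDiffOn.congr (q.derivWithin_integral_lift v)⟩
  -- The remaining clause concerns the analytic order `ω`, which a natural number is not.
  exact absurd h (by simp)

/-- On the circle two parameters of a point differ by a whole number of periods, and the exact part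
integrates to zero over a period. Hence the primitive descends to `D`. -/
theorem integral_lift_exactPart_eq (q : Curve D k d) (v : Euc d) (s : ℝ) (hs : s ∈ D.paramSet)
    (t : ℝ) (ht : t ∈ D.paramSet) (h : D.param s = D.param t) :
    v + ∫ r in (0 : ℝ)..s, (exactPart D k d q).lift r =
      v + ∫ r in (0 : ℝ)..t, (exactPart D k d q).lift r := by
  cases D with
  | interval =>
    have : s = t := by
      have h' := congrArg (fun z : Icc (0 : ℝ) 1 => (z : ℝ)) h
      simpa [CurveDomain.param, projIcc_of_mem zero_le_one hs, projIcc_of_mem zero_le_one ht]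
        using h'
    rw [this]
  | circle =>
    obtain ⟨m, rfl⟩ := (CurveDomain.param_eq_iff_circle s t).1 h
    set p := exactPart .circle k d q
    have hi : ∀ a b, IntervalIntegrable p.lift MeasureTheory.volume a b := fun a b =>
      p.continuous_lift.intervalIntegrable a b
    rw [← intervalIntegral.integral_add_adjacent_intervals (hi 0 t) (hi t _)]
    have h0 : ∫ r in (0 : ℝ)..(2 * Real.pi), p.lift r = 0 := integral_exactPart_circle q
    have h1 := p.lift_periodic.intervalIntegral_add_zsmul_eq m t
    have h2 := p.lift_periodic.intervalIntegral_add_eq t 0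
    rw [zero_add] at h2
    rw [zsmul_eq_mul] at h1
    rw [h1 hi, h2, h0, smul_zero, add_zero]

/-- The curve with a prescribed initial value, whose derivative is the exact part of a curve. -/
def primitiveFun (v : Euc d) (q : Curve D k d) : Curve D (k + 1) d :=
  ofParam (fun t => v + ∫ s in (0 : ℝ)..t, (exactPart D k d q).lift s)
    ((exactPart D k d q).contDiffOn_integral_lift v) (q.integral_lift_exactPart_eq v)

theorem primitiveFun_lift (v : Euc d) (q : Curve D k d) :
    EqOn (primitiveFun v q).lift (fun t => v + ∫ s in (0 : ℝ)..t, (exactPart D k d q).lift s)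
      D.paramSet := ofParam_lift _ _

theorem derivWithin_primitiveFun (v : Euc d) (q : Curve D k d) :
    EqOn (derivWithin (primitiveFun v q).lift D.paramSet) (exactPart D k d q).lift D.paramSet :=
  fun t ht => by
    rw [derivWithin_congr (primitiveFun_lift v q) (primitiveFun_lift v q ht)]
    exact derivWithin_integral_lift _ v ht

theorem norm_primitiveFun_le (v : Euc d) (q : Curve D k d) :
    ‖primitiveFun v q‖ ≤ ‖v‖ + 4 * ‖exactPart D k d q‖ := by
  have h0 : 0 ≤ ‖exactPart D k d q‖ := norm_nonneg _
  refine norm_le_succ (by positivity) _ (derivWithin_primitiveFun v q) (fun x => ?_)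
    (by linarith [norm_nonneg v])
  obtain ⟨t, ht, rfl⟩ := D.param_surjective x
  change ‖(primitiveFun v q).lift t‖ ≤ _
  rw [primitiveFun_lift v q (D.window_subset ht)]
  refine (norm_add_le _ _).trans (add_le_add le_rfl ?_)
  refine (intervalIntegral.norm_integral_le_of_norm_le_const (C := ‖exactPart D k d q‖)
    fun s _ => norm_apply_le _ _).trans ?_
  rw [sub_zero, mul_comm]
  exact mul_le_mul_of_nonneg_right (CurveDomain.abs_le_of_mem_window ht) h0

/-- Reconstruction of a curve from its initial value and its derivative. -/
def primitive : Euc d × Curve D k d →L[ℝ] Curve D (k + 1) d :=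
  LinearMap.mkContinuous
    { toFun := fun p => primitiveFun p.1 p.2
      map_add' := fun p q => ext_lift fun t ht => by
        change _ = (primitiveFun p.1 p.2).lift t + (primitiveFun q.1 q.2).lift t
        rw [primitiveFun_lift _ _ ht, primitiveFun_lift _ _ ht, primitiveFun_lift _ _ ht]
        simp only [← integral_apply, Prod.fst_add, Prod.snd_add, map_add]
        abel
      map_smul' := fun c p => ext_lift fun t ht => by
        change _ = c • (primitiveFun p.1 p.2).lift t
        rw [primitiveFun_lift _ _ ht, primitiveFun_lift _ _ ht]
        simp only [← integral_apply, Prod.smul_fst, Prod.smul_snd, map_smul, smul_add] }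
    (1 + 4 * ‖exactPart D k d‖) fun p => by
    refine (norm_primitiveFun_le p.1 p.2).trans ?_
    rw [add_mul, one_mul, mul_assoc]
    refine add_le_add (norm_fst_le p) (mul_le_mul_of_nonneg_left ?_ (by norm_num))
    exact ((exactPart D k d).le_opNorm p.2).trans
      (mul_le_mul_of_nonneg_left (norm_snd_le p) (norm_nonneg _))

/-- The derivative of a periodic function has zero integral over a period, so no mean value is
subtracted. -/
theorem exactPart_deriv (q : Curve D (k + 1) d) :
    exactPart D k d (deriv le_rfl q) = deriv le_rfl q := by
  cases D with
  | interval => rfl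
  | circle =>
    have h : integral 0 (2 * Real.pi) (deriv (m := k) le_rfl q) = 0 := by
      have hd : ∀ t ∈ uIcc 0 (2 * Real.pi), HasDerivAt q.lift ((deriv (m := k) le_rfl q).lift t) t := by
        intro t _
        rw [deriv_lift (m := k) le_rfl q (mem_univ t)]
        exact ((q.differentiableOn_lift (by omega) t (mem_univ t)).hasDerivWithinAt).hasDerivAt
          univ_mem
      rw [integral_apply, intervalIntegral.integral_eq_sub_of_hasDerivAt hd
        ((continuous_lift _).intervalIntegrable _ _), sub_eq_zero]
      exact q.lift_periodic.eq
    rw [exactPart_circle, h, map_zero, smul_zero, sub_zero]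

/-- This converts regularity of a map into `C^{k+1}(D)` into regularity of its initial value in
`ℝ^d` and of its derivative in `C^k(D)`, which drives the induction on `k`. -/
theorem primitive_eval_deriv (q : Curve D (k + 1) d) :
    primitive (eval (D.param 0) q, deriv le_rfl q) = q := by
  refine ext_lift fun t ht => ?_
  have h0 : (0 : ℝ) ∈ D.paramSet := D.window_subset D.zero_mem_window
  set p : Curve D (k + 1) d := primitive (eval (D.param 0) q, deriv le_rfl q) with hp
  have hp0 : p.lift 0 = q.lift 0 := by
    refine (primitiveFun_lift _ _ h0).trans ?_
    simp only [intervalIntegral.integral_same, add_zero]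
    rfl
  have hd : EqOn (derivWithin p.lift D.paramSet) (derivWithin q.lift D.paramSet) D.paramSet := by
    intro s hs
    refine (derivWithin_primitiveFun _ _ hs).trans ?_
    rw [exactPart_deriv, deriv_lift _ _ hs]
  -- The difference of the two lifts has zero derivative on a convex set, hence is constant, and it
  -- vanishes at the parameter `0`.
  have hc := D.convex_paramSet.norm_image_sub_le_of_norm_hasDerivWithin_le (f := p.lift - q.lift)
    (C := 0) (f' := fun _ => 0) (fun s hs => ?_) (fun s hs => by simp) h0 ht
  · simp only [zero_mul, norm_le_zero_iff, Pi.sub_apply, hp0, sub_self, sub_zero] at hc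
    exact sub_eq_zero.1 hc
  · have := ((p.differentiableOn_lift (by omega) s hs).hasDerivWithinAt).sub
      ((q.differentiableOn_lift (by omega) s hs).hasDerivWithinAt)
    rwa [hd hs, sub_self] at this

/-! ### Differentiability of the composition of vector fields and curves -/

/-- The composition `u ∘ q` of a vector field and a curve. -/
def comp (u : C0k k d) (q : Curve D k d) : Curve D k d :=
  ⟨fun x => u (q x), u.contDiff.comp_contDiffOn q.contDiffOn⟩

/-- The composition with a continuous curve, as an operator on vector fields. -/
def compOp (n : ℕ) (q : Curve D 0 d) : C0k n d →L[ℝ] Curve D 0 d :=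
  LinearMap.mkContinuous
    { toFun := fun u => comp (C0k.restrict (Nat.zero_le n) u) q
      map_add' := fun _ _ => rfl
      map_smul' := fun _ _ => rfl } 1 fun u => by
    rw [one_mul]
    exact norm_le_zero (norm_nonneg u) fun x => u.norm_apply_le (q x)

theorem sum_mulCoord_compOp_pderiv_apply (h : m + 1 ≤ n) (u : C0k n d) (q v : Curve D 0 d)
    (x : D.Point) :
    (∑ j, mulCoord j (compOp m q (C0k.pderiv h j u)) v) x = fderiv ℝ u (q x) (v x) := by
  rw [sum_apply, ← C0k.sum_coord_smul_pderiv h]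
  rfl

theorem norm_compOp_sub_le (h : 1 ≤ n) (p q : Curve D 0 d) (u : C0k n d) :
    ‖compOp n p u - compOp n q u‖ ≤ ‖p - q‖ * ‖u‖ :=
  norm_le_zero (by positivity) fun x => by
    rw [mul_comm]
    exact (u.norm_sub_le h (p x) (q x)).trans
      (mul_le_mul_of_nonneg_left ((p - q).norm_apply_le x) (norm_nonneg u))

/-- Continuity in operator norm is obtained from one derivative of the fields: fields of norm at
most one are uniformly Lipschitz. -/
theorem continuous_compOp (h : 1 ≤ n) :
    Continuous (compOp n : Curve D 0 d → C0k n d →L[ℝ] Curve D 0 d) := by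
  refine (LipschitzWith.of_dist_le_mul (K := 1) fun p q => ?_).continuous
  rw [dist_eq_norm, dist_eq_norm, NNReal.coe_one, one_mul]
  exact ContinuousLinearMap.opNorm_le_bound _ (norm_nonneg _) (norm_compOp_sub_le h p q)

/-- The derivative of `q ↦ (u ↦ u ∘ q)`. -/
def compOpDeriv (n : ℕ) (q : Curve D 0 d) : Curve D 0 d →L[ℝ] C0k (n + 1) d →L[ℝ] Curve D 0 d :=
  ∑ j, ContinuousLinearMap.flip ((mulCoord j).comp ((compOp n q).comp (C0k.pderiv le_rfl j)))

theorem compOpDeriv_apply (q v : Curve D 0 d) (u : C0k (n + 1) d) :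
    compOpDeriv n q v u = ∑ j, mulCoord j (compOp n q (C0k.pderiv le_rfl j u)) v := by
  simp [compOpDeriv]

/-- With two derivatives available on the fields, the Taylor remainder is at most `‖v‖ ^ 2 * ‖u‖`,
so it is quadratic in `v` for the operator norm. -/
theorem hasFDerivAt_compOp (h : 1 ≤ n) (q : Curve D 0 d) :
    HasFDerivAt (compOp (n + 1) : Curve D 0 d → C0k (n + 1) d →L[ℝ] Curve D 0 d)
      (compOpDeriv n q) q := by
  rw [hasFDerivAt_iff_isLittleO_nhds_zero]
  refine Asymptotics.IsBigO.trans_isLittleO (g := fun v : Curve D 0 d => ‖v‖ ^ 2) ?_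
    (Asymptotics.isLittleO_norm_pow_id one_lt_two)
  refine Asymptotics.IsBigO.of_bound 1 (Eventually.of_forall fun v => ?_)
  rw [one_mul, Real.norm_of_nonneg (by positivity)]
  refine ContinuousLinearMap.opNorm_le_bound _ (by positivity) fun u => ?_
  refine norm_le_zero (by positivity) fun x => ?_
  change ‖u (q x + v x) - u (q x) - (compOpDeriv n q v u) x‖ ≤ _
  rw [compOpDeriv_apply, sum_mulCoord_compOp_pderiv_apply]
  have hv := v.norm_apply_le x
  refine (u.norm_taylor_le (by omega) (C := ‖u‖ * ‖v x‖) fun z hz => ?_).trans ?_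
  · exact (u.norm_fderiv_sub_le (by omega) _ _).trans
      (mul_le_mul_of_nonneg_left hz (norm_nonneg u))
  · calc ‖u‖ * ‖v x‖ * ‖v x‖ ≤ ‖u‖ * ‖v‖ * ‖v‖ := by gcongr
      _ = ‖v‖ ^ 2 * ‖u‖ := by ring

theorem contDiff_flip {E F G : Type*} [NormedAddCommGroup E] [NormedSpace ℝ E]
    [NormedAddCommGroup F] [NormedSpace ℝ F] [NormedAddCommGroup G] [NormedSpace ℝ G] {l : ℕ∞ω} :
    ContDiff ℝ l fun A : E →L[ℝ] F →L[ℝ] G => A.flip :=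
  (IsLinearMap.with_bound (M := 1) ⟨fun _ _ => rfl, fun _ _ => rfl⟩ fun A => by
    rw [ContinuousLinearMap.opNorm_flip, one_mul]).contDiff

/-- The derivative of `compOp (l + 2)` is built linearly from `compOp (l + 1)` and the operators
`∂_j`, so each order of smoothness costs one derivative of the fields. The additional `1` pays for
norm continuity in the base case. -/
theorem contDiff_compOp (l : ℕ) :
    ContDiff ℝ l (compOp (l + 1) : Curve D 0 d → C0k (l + 1) d →L[ℝ] Curve D 0 d) := by
  induction l with
  | zero => exact contDiff_zero.2 (continuous_compOp le_rfl)
  | succ l ih =>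
    rw [Nat.cast_add, Nat.cast_one]
    refine contDiff_succ_iff_hasFDerivAt.2 ⟨compOpDeriv (l + 1), ?_,
      fun q => hasFDerivAt_compOp (by omega) q⟩
    refine ContDiff.sum fun j _ => ?_
    exact contDiff_flip.comp
      (contDiff_const.clm_comp (ih.clm_comp contDiff_const))

/-- Split `v ∘ p - u ∘ q` into `(v - u) ∘ p`, controlled by the uniform norm, and `u ∘ p - u ∘ q`,
controlled by the uniform continuity of the fixed field `u`. -/
theorem continuous_comp_zero :
    Continuous fun p : C0k 0 d × Curve D 0 d => compOp 0 p.2 p.1 := by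
  rw [continuous_iff_continuousAt]
  rintro ⟨u, q⟩
  rw [Metric.continuousAt_iff]
  intro ε hε
  obtain ⟨δ, hδ, hu⟩ := Metric.uniformContinuous_iff.1 u.uniformContinuous (ε / 3) (by positivity)
  refine ⟨min δ (ε / 3), by positivity, ?_⟩
  rintro ⟨v, p⟩ hp
  rw [Prod.dist_eq, max_lt_iff, lt_min_iff, lt_min_iff] at hp
  rw [dist_eq_norm]
  refine lt_of_le_of_lt (norm_le_zero (C := ε / 3 + ε / 3) (by positivity) fun x => ?_) (by linarith)
  have h1 : ‖v (p x) - u (p x)‖ ≤ ε / 3 := by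
    have := (v - u).norm_apply_le (p x)
    have h2 := hp.1.2
    rw [dist_eq_norm] at h2
    exact this.trans h2.le
  have h2 : ‖u (p x) - u (q x)‖ ≤ ε / 3 := by
    rw [← dist_eq_norm]
    refine (hu ?_).le
    have h3 := hp.2.1
    rw [dist_eq_norm] at h3 ⊢
    exact ((p - q).norm_apply_le x).trans_lt h3
  calc ‖v (p x) - u (q x)‖ = ‖(v (p x) - u (p x)) + (u (p x) - u (q x))‖ := by
        rw [sub_add_sub_cancel]
    _ ≤ _ := (norm_add_le _ _).trans (add_le_add h1 h2)

/-- The remainder is the Taylor remainder of `u`, small by uniform continuity of `Du`, plus `v(q +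
p) - v(q)`, which is at most `‖v‖ * ‖p‖` because `v` is Lipschitz. -/
theorem hasFDerivAt_comp_zero (u : C0k (n + 1) d) (q : Curve D 0 d) :
    HasFDerivAt (fun p : C0k (n + 1) d × Curve D 0 d => compOp (n + 1) p.2 p.1)
      ((compOp (n + 1) q).comp (ContinuousLinearMap.fst ℝ _ _) +
        (∑ j, mulCoord j (compOp n q (C0k.pderiv le_rfl j u))).comp
          (ContinuousLinearMap.snd ℝ _ _)) (u, q) := by
  rw [hasFDerivAt_iff_isLittleO_nhds_zero, Asymptotics.isLittleO_iff]
  intro c hc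
  obtain ⟨δ, hδ, hu⟩ := Metric.uniformContinuous_iff.1
    (u.uniformContinuous_fderiv (by omega)) (c / 2) (by positivity)
  -- The radius `δ` controls the oscillation of `Du` along the segment, and `c / 2` controls the
  -- factor `‖v‖`; each error takes half of `c`.
  filter_upwards [Metric.ball_mem_nhds (0 : C0k (n + 1) d × Curve D 0 d)
    (ε := min δ (c / 2)) (by positivity)] with ⟨v, p⟩ hp
  rw [mem_ball_zero_iff, lt_min_iff] at hp
  have hv : ‖v‖ ≤ ‖(v, p)‖ := norm_fst_le (v, p)
  have hp' : ‖p‖ ≤ ‖(v, p)‖ := norm_snd_le (v, p)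
  refine norm_le_zero (by positivity) fun x => ?_
  have hpx := p.norm_apply_le x
  have e : (∑ j, mulCoord j (compOp n q (C0k.pderiv le_rfl j u)) p) x = fderiv ℝ u (q x) (p x) :=
    sum_mulCoord_compOp_pderiv_apply le_rfl u q p x
  have e' : (compOp (n + 1) (q + p) (u + v) - compOp (n + 1) q u - (compOp (n + 1) q v +
      ∑ j, mulCoord j (compOp n q (C0k.pderiv le_rfl j u)) p)) x =
      (u (q x + p x) - u (q x) - fderiv ℝ u (q x) (p x)) + (v (q x + p x) - v (q x)) := by
    rw [← e]
    change (u (q x + p x) + v (q x + p x)) - u (q x) - (v (q x) + _) = _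
    abel
  have e'' : ((∑ j, mulCoord j (compOp n q (C0k.pderiv le_rfl j u))) p) =
      ∑ j, mulCoord j (compOp n q (C0k.pderiv le_rfl j u)) p := _root_.sum_apply _ _ _
  simp only [_root_.add_apply, ContinuousLinearMap.comp_apply, ContinuousLinearMap.coe_fst',
    ContinuousLinearMap.coe_snd', Prod.mk_add_mk, e'', e']
  have h1 : ‖u (q x + p x) - u (q x) - fderiv ℝ u (q x) (p x)‖ ≤ c / 2 * ‖p x‖ := by
    refine u.norm_taylor_le (by omega) fun z hz => ?_
    rw [← dist_eq_norm]
    refine (hu ?_).le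
    rw [dist_eq_norm]
    exact (hz.trans (hpx.trans hp')).trans_lt hp.1
  have h2 : ‖v (q x + p x) - v (q x)‖ ≤ ‖v‖ * ‖p x‖ := by
    have := v.norm_sub_le (by omega) (q x + p x) (q x)
    rwa [add_sub_cancel_left] at this
  refine (norm_add_le _ _).trans ((add_le_add h1 h2).trans ?_)
  rw [← add_mul]
  exact mul_le_mul (by linarith [hp.2]) (hpx.trans hp') (norm_nonneg _) hc.le

/-- In the derivative, the part acting on fields is `C^l` in `q` by `contDiff_compOp`, and the part
acting on curves is composition with the `∂_j u`, covered by the induction hypothesis. -/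
theorem contDiff_comp_zero (l : ℕ) :
    ContDiff ℝ l fun p : C0k l d × Curve D 0 d => compOp l p.2 p.1 := by
  induction l with
  | zero => exact contDiff_zero.2 continuous_comp_zero
  | succ l ih =>
    rw [Nat.cast_add, Nat.cast_one]
    refine contDiff_succ_iff_hasFDerivAt.2 ⟨_, ?_, fun p => hasFDerivAt_comp_zero p.1 p.2⟩
    refine (((contDiff_compOp l).comp contDiff_snd).clm_comp contDiff_const).add
      (ContDiff.clm_comp (ContDiff.sum fun j _ => ?_) contDiff_const)
    exact (mulCoord j).contDiff.comp
      (ih.comp (((C0k.pderiv le_rfl j).contDiff.comp contDiff_fst).prodMk contDiff_snd))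

/-- The chain rule in coordinates: the derivative of a composition is again made of compositions, of
lower order in both the field and the curve. -/
theorem deriv_comp (h : m + 1 ≤ n) (u : C0k n d) (q : Curve D n d) :
    deriv h (comp u q) =
      ∑ j, mulCoord j (comp (C0k.pderiv h j u) (restrict (by omega) q)) (deriv h q) := by
  refine ext_lift fun t ht => ?_
  rw [deriv_lift h _ ht]
  have h1 : derivWithin (u ∘ q.lift) D.paramSet t
      = fderiv ℝ u (q.lift t) (derivWithin q.lift D.paramSet t) :=
    ((u.differentiable (by omega) _).hasFDerivAt.comp_hasDerivWithinAt t
      (q.differentiableOn_lift (by omega) t ht).hasDerivWithinAt).derivWithin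
        (D.uniqueDiffOn t ht)
  refine h1.trans ?_
  rw [← deriv_lift h q ht, ← C0k.sum_coord_smul_pderiv h]
  exact (sum_apply Finset.univ (fun j => mulCoord j
    (comp (C0k.pderiv h j u) (restrict (by omega) q)) (deriv h q)) (D.param t)).symm

/-- The composition `(u, q) ↦ u ∘ q` of a vector field of class `C_0^{k+l}` with a curve of class
`C^k` is of class `C^l`. -/
theorem contDiff_comp (k l n : ℕ) (h : k + l ≤ n) :
    ContDiff ℝ l fun p : C0k n d × Curve D k d =>
      comp (C0k.restrict ((Nat.le_add_right k l).trans h) p.1) p.2 := by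
  -- The order `n` varies because the induction hypothesis is used twice: with `u` itself, at order
  -- `n`, for the initial value, and with `∂_j u`, at order `k + l`, for the derivative.
  induction k generalizing n with
  | zero =>
    exact (contDiff_comp_zero l).comp
      (((C0k.restrict (by omega : l ≤ n)).contDiff.comp contDiff_fst).prodMk contDiff_snd)
  | succ k ih =>
    have hq : ContDiff ℝ l fun p : C0k n d × Curve D (k + 1) d => restrict k.le_succ p.2 :=
      (restrict k.le_succ).contDiff.comp contDiff_snd
    have h0 : ContDiff ℝ l fun p : C0k n d × Curve D (k + 1) d =>
        eval (D.param 0) (comp (C0k.restrict (by omega) p.1) (restrict k.le_succ p.2)) :=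
      (eval (D.param 0)).contDiff.comp ((ih n (by omega)).comp (contDiff_fst.prodMk hq))
    have h1 : ContDiff ℝ l fun p : C0k n d × Curve D (k + 1) d =>
        ∑ j, mulCoord j (comp (C0k.restrict (Nat.le_add_right k l)
          (C0k.pderiv (by omega : k + l + 1 ≤ n) j p.1)) (restrict k.le_succ p.2))
          (deriv le_rfl p.2) := by
      refine ContDiff.sum fun j _ => ?_
      refine ((mulCoord j).contDiff.comp ((ih (k + l) le_rfl).comp
        (((C0k.pderiv _ j).contDiff.comp contDiff_fst).prodMk hq))).clm_apply
        ((deriv le_rfl).contDiff.comp contDiff_snd)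
    -- The composition is the primitive of its initial value and its derivative, both of class `C^l`
    -- in `(u, q)`.
    convert primitive.contDiff.comp (h0.prodMk h1) using 1
    funext p
    rw [← primitive_eval_deriv (comp (C0k.restrict _ p.1) p.2), deriv_comp]
    rfl

end Curve

/-! ### Smooth structure of `SO_d` and of the rigid motions -/

namespace SO

variable {d : ℕ}

/-- Near `R₀` the matrix of `R` is `R₀` times the Cayley transform of its chart coordinate, and the
Cayley transform is smooth at every skew-symmetric matrix. -/
theorem contMDiff_coe : ContMDiff 𝓘(ℝ, Skew d) 𝓘(ℝ, Mat d) ∞ fun R : SO d => R.1 := by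
  intro R₀
  have h1 : ContMDiffAt 𝓘(ℝ, Skew d) 𝓘(ℝ, Skew d) ∞ (extChartAt 𝓘(ℝ, Skew d) R₀) R₀ :=
    contMDiffAt_extChartAt
  have h2 : ContDiff ℝ ∞ fun A : Skew d => R₀.1 * cayleyMat A.1 :=
    contDiff_iff_contDiffAt.2 fun A => contDiffAt_const.mul
      (ContDiffAt.comp A (contDiffAt_cayleyMat A) (Skew d).subtypeL.contDiff.contDiffAt)
  refine (h2.contMDiff.contMDiffAt.comp R₀ h1).congr_of_eventuallyEq ?_
  filter_upwards [(chartAt (Skew d) R₀).open_source.mem_nhds (mem_chart_source _ R₀)] with R hR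
  exact (congrArg Subtype.val ((chartAt (Skew d) R₀).left_inv hR)).symm

variable {E H M : Type*} [NormedAddCommGroup E] [NormedSpace ℝ E] [TopologicalSpace H]
  {I : ModelWithCorners ℝ E H} [TopologicalSpace M] [ChartedSpace H M]

/-- The formula of the Cayley chart at `f x` is smooth on a neighbourhood in the whole matrix space,
so composing it with the matrix of `f` gives the chart expression. -/
theorem contMDiff_of_coe {f : M → SO d}
    (hf : ContMDiff I 𝓘(ℝ, Mat d) ∞ fun x => (f x).1) : ContMDiff I 𝓘(ℝ, Skew d) ∞ f := by
  intro x
  rw [contMDiffAt_iff_target]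
  refine ⟨(continuous_induced_rng.2 hf.continuous).continuousAt, ?_⟩
  have h1 : ContDiffAt ℝ ∞
      (fun U : Mat d => Skew.proj d (cayleyInvMat ((f x).1ᵀ * U))) (f x).1 := by
    have hu : IsUnit ((f x).1ᵀ * (f x).1 + 1) := mem_chart_source (Skew d) (f x)
    exact (Skew.proj d).contDiff.contDiffAt.comp _ (ContDiffAt.comp (g := cayleyInvMat) _
      (contDiffAt_cayleyInvMat hu) (contDiffAt_const.mul contDiffAt_id))
  exact ContMDiffAt.comp (g := fun U : Mat d => Skew.proj d (cayleyInvMat ((f x).1ᵀ * U)))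
    (f := fun x => (f x).1) x h1.contMDiffAt (hf x)

/-- The rotation with a given matrix, as a continuous linear map of the matrix. -/
def matToCLM (d : ℕ) : Mat d →L[ℝ] Euc d →L[ℝ] Euc d :=
  LinearMap.toContinuousLinearMap
    (Matrix.toEuclideanCLM (n := Fin d) (𝕜 := ℝ)).toAlgEquiv.toLinearMap

end SO

namespace Isom

variable {d : ℕ}

theorem contMDiff_rot : ContMDiff (model d) 𝓘(ℝ, Skew d) ∞ (rot : Isom d → SO d) :=
  contMDiff_fst (I := 𝓘(ℝ, Skew d)) (J := 𝓘(ℝ, Euc d)) (M := SO d) (N := Euc d)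

theorem contMDiff_trans : ContMDiff (model d) 𝓘(ℝ, Euc d) ∞ (trans : Isom d → Euc d) :=
  contMDiff_snd (I := 𝓘(ℝ, Skew d)) (J := 𝓘(ℝ, Euc d)) (M := SO d) (N := Euc d)

theorem contMDiff_toCLM_rot :
    ContMDiff (model d) 𝓘(ℝ, Euc d →L[ℝ] Euc d) ∞ fun g : Isom d => SO.toCLM g.rot :=
  (SO.matToCLM d).contDiff.contMDiff.comp (SO.contMDiff_coe.comp contMDiff_rot)

theorem contMDiff_mul :
    ContMDiff ((model d).prod (model d)) (model d) ∞ fun p : Isom d × Isom d => p.1 * p.2 := by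
  have h1 : ContMDiff ((model d).prod (model d)) 𝓘(ℝ, Skew d) ∞
      fun p : Isom d × Isom d => p.1.rot * p.2.rot := by
    refine SO.contMDiff_of_coe ?_
    have hm : ContDiff ℝ ∞ fun p : Mat d × Mat d => p.1 * p.2 := contDiff_mul
    exact hm.contMDiff.comp ((SO.contMDiff_coe.comp (contMDiff_rot.comp contMDiff_fst)).prodMk_space
      (SO.contMDiff_coe.comp (contMDiff_rot.comp contMDiff_snd)))
  have h2 : ContMDiff ((model d).prod (model d)) 𝓘(ℝ, Euc d) ∞
      fun p : Isom d × Isom d => SO.toCLM p.1.rot p.2.trans + p.1.trans :=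
    ((contMDiff_toCLM_rot.comp contMDiff_fst).clm_apply (contMDiff_trans.comp contMDiff_snd)).add
      (contMDiff_trans.comp contMDiff_fst)
  exact h1.prodMk h2

end Isom

/-! ### Open subsets of normed spaces and their tangent bundles -/

namespace TopologicalSpace.Opens

variable {E : Type*} [NormedAddCommGroup E] [NormedSpace ℝ E] {U : Opens E}
  {F H M : Type*} [NormedAddCommGroup F] [NormedSpace ℝ F] [TopologicalSpace H]
  {I : ModelWithCorners ℝ F H} [TopologicalSpace M] [ChartedSpace H M] {n : ℕ∞ω}

/-- The chart is the inclusion, but its inverse is meaningful only on the target of the chart; hence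
a statement near the point. -/
theorem extChartAt_vectorSpace_symm_eventuallyEq (x : U) :
    ∀ᶠ y in 𝓝 (x : E), (((extChartAt 𝓘(ℝ, E) x).symm y : U) : E) = y := by
  have h := extChartAt_target_mem_nhds (I := 𝓘(ℝ, E)) x
  filter_upwards [h] with y hy
  exact (extChartAt 𝓘(ℝ, E) x).right_inv hy

theorem contMDiff_of_val {f : M → U} (hf : ContMDiff I 𝓘(ℝ, E) n fun x => (f x : E)) :
    ContMDiff I 𝓘(ℝ, E) n f := fun x =>
  contMDiffAt_iff_target.2 ⟨(continuous_induced_rng.2 hf.continuous).continuousAt, hf x⟩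

theorem hasMFDerivAt_val (x : U) :
    HasMFDerivAt 𝓘(ℝ, E) 𝓘(ℝ, E) (Subtype.val : U → E) x (ContinuousLinearMap.id ℝ E) := by
  refine ⟨continuous_subtype_val.continuousAt, ?_⟩
  refine ((hasFDerivAt_id (𝕜 := ℝ) (x : E)).congr_of_eventuallyEq ?_).hasFDerivWithinAt
  exact extChartAt_vectorSpace_symm_eventuallyEq x

/-- Changes of charts are locally the identity, so every trivialization of the tangent bundle reads
a vector as itself. -/
theorem trivializationAt_vectorSpace_snd (x y : U) (v : E) :
    (trivializationAt E (TangentSpace 𝓘(ℝ, E)) x (⟨y, v⟩ : TangentBundle 𝓘(ℝ, E) U)).2 = v := by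
  rw [TangentBundle.trivializationAt_apply]
  have h : HasFDerivAt ((extChartAt 𝓘(ℝ, E) x) ∘ (extChartAt 𝓘(ℝ, E) y).symm)
      (ContinuousLinearMap.id ℝ E) (y : E) :=
    (hasFDerivAt_id (𝕜 := ℝ) (y : E)).congr_of_eventuallyEq
      (extChartAt_vectorSpace_symm_eventuallyEq y)
  have h2 := h.hasFDerivWithinAt (s := range 𝓘(ℝ, E))
  have h3 := h2.fderivWithin (by
    rw [modelWithCornersSelf_coe, range_id]; exact uniqueDiffWithinAt_univ)
  exact congrArg (fun L : E →L[ℝ] E => L v) h3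

theorem contMDiff_tangentBundle_mk {f : M → U} {w : M → E} (hf : ContMDiff I 𝓘(ℝ, E) n f)
    (hw : ContMDiff I 𝓘(ℝ, E) n w) :
    ContMDiff I 𝓘(ℝ, E).tangent n fun x => (⟨f x, w x⟩ : TangentBundle 𝓘(ℝ, E) U) := by
  intro x
  rw [Bundle.contMDiffAt_totalSpace]
  refine ⟨hf x, ?_⟩
  refine (hw x).congr_of_eventuallyEq (Eventually.of_forall fun y => ?_)
  exact trivializationAt_vectorSpace_snd _ _ _

end TopologicalSpace.Opens

section

variable {E : Type*} [NormedAddCommGroup E] [NormedSpace ℝ E]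
  {H M : Type*} [TopologicalSpace H] {I : ModelWithCorners ℝ E H} [TopologicalSpace M]
  [ChartedSpace H M] [IsManifold I 1 M]

/-- In the trivialization centred at `x`, the fibre over `x` is read through the coordinate change
of a chart with itself, which is the identity. -/
theorem contMDiff_tangentSpace_inclusion (x : M) {n : ℕ∞ω} :
    ContMDiff 𝓘(ℝ, E) I.tangent n fun v : E => (⟨x, v⟩ : TangentBundle I M) := by
  intro v
  rw [Bundle.contMDiffAt_totalSpace]
  refine ⟨contMDiffAt_const, ?_⟩
  refine contMDiffAt_id.congr_of_eventuallyEq (Eventually.of_forall fun w => ?_)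
  exact (tangentBundleCore I M).coordChange_self (achart H x) x (mem_achart_source H x) w

end

/-! ### Composition as an operator, and coordinates on the groups -/

namespace Curve

variable {D : CurveDomain} {k d : ℕ}

theorem continuous_comp : Continuous fun p : C0k k d × Curve D k d => comp p.1 p.2 :=
  (contDiff_comp k 0 k le_rfl).continuous

/-- The composition with a curve of class `C^k`, as an operator on vector fields. -/
def compCLM (q : Curve D k d) : C0k k d →L[ℝ] Curve D k d where
  toFun u := comp u q
  map_add' _ _ := rfl
  map_smul' _ _ := rfl
  cont := continuous_comp.comp (continuous_id.prodMk continuous_const)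

end Curve

namespace Diff0

variable {k d : ℕ} [NeZero k]

theorem contMDiff_disp :
    ContMDiff 𝓘(ℝ, C0k k d) 𝓘(ℝ, C0k k d) ∞ (disp : Diff0 k d → C0k k d) :=
  contMDiff_subtype_val (U := diffOpens k d)

theorem hasMFDerivAt_disp (φ : Diff0 k d) :
    HasMFDerivAt 𝓘(ℝ, C0k k d) 𝓘(ℝ, C0k k d) (disp : Diff0 k d → C0k k d) φ
      (ContinuousLinearMap.id ℝ (C0k k d)) :=
  TopologicalSpace.Opens.hasMFDerivAt_val (U := diffOpens k d) φ

end Diff0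

namespace IsomDiff

variable {k d : ℕ} [NeZero k]

theorem contMDiff_isom : ContMDiff (model k d) (Isom.model d) ∞ (isom : IsomDiff k d → Isom d) :=
  contMDiff_fst (I := Isom.model d) (J := 𝓘(ℝ, C0k k d)) (M := Isom d) (N := Diff0 k d)

theorem contMDiff_diff :
    ContMDiff (model k d) 𝓘(ℝ, C0k k d) ∞ (diff : IsomDiff k d → Diff0 k d) :=
  contMDiff_snd (I := Isom.model d) (J := 𝓘(ℝ, C0k k d)) (M := Isom d) (N := Diff0 k d)

theorem hasMFDerivAt_isom (a : IsomDiff k d) :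
    HasMFDerivAt (model k d) (Isom.model d) (isom : IsomDiff k d → Isom d) a
      (ContinuousLinearMap.fst ℝ (Skew d × Euc d) (C0k k d)) :=
  hasMFDerivAt_fst (I := Isom.model d) (I' := 𝓘(ℝ, C0k k d)) (M := Isom d) (M' := Diff0 k d) a

theorem hasMFDerivAt_diff (a : IsomDiff k d) :
    HasMFDerivAt (model k d) 𝓘(ℝ, C0k k d) (diff : IsomDiff k d → Diff0 k d) a
      (ContinuousLinearMap.snd ℝ (Skew d × Euc d) (C0k k d)) :=
  hasMFDerivAt_snd (I := Isom.model d) (I' := 𝓘(ℝ, C0k k d)) (M := Isom d) (M' := Diff0 k d) a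

end IsomDiff

/-! ### The actions of rigid motions and of diffeomorphisms on immersions -/

namespace Imm

variable {D : CurveDomain} {k d : ℕ} [NeZero k]
  {E H M : Type*} [NormedAddCommGroup E] [NormedSpace ℝ E] [TopologicalSpace H]
  {I : ModelWithCorners ℝ E H} [TopologicalSpace M] [ChartedSpace H M] {n : ℕ∞ω}

theorem contMDiff_curve :
    ContMDiff 𝓘(ℝ, Curve D k d) 𝓘(ℝ, Curve D k d) ∞ (curve : Imm D k d → Curve D k d) :=
  contMDiff_subtype_val (U := immOpens D k d)

theorem contMDiff_of_curve {f : M → Imm D k d}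
    (hf : ContMDiff I 𝓘(ℝ, Curve D k d) n fun x => (f x).curve) :
    ContMDiff I 𝓘(ℝ, Curve D k d) n f :=
  TopologicalSpace.Opens.contMDiff_of_val (U := immOpens D k d) hf

theorem hasMFDerivAt_curve (q : Imm D k d) :
    HasMFDerivAt 𝓘(ℝ, Curve D k d) 𝓘(ℝ, Curve D k d) (curve : Imm D k d → Curve D k d) q
      (ContinuousLinearMap.id ℝ (Curve D k d)) :=
  TopologicalSpace.Opens.hasMFDerivAt_val (U := immOpens D k d) q

/-- The curve of `g • q` is `R q + T`, where `R q` is the bounded bilinear map `Curve.postcompL` and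
`T` enters through constant curves. -/
theorem contMDiff_isom_smul :
    ContMDiff ((Isom.model d).prod 𝓘(ℝ, Curve D k d)) 𝓘(ℝ, Curve D k d) ∞
      (fun p : Isom d × Imm D k d => p.1 • p.2) := by
  refine contMDiff_of_curve ?_
  have h1 : ContMDiff ((Isom.model d).prod 𝓘(ℝ, Curve D k d))
      𝓘(ℝ, Curve D k d →L[ℝ] Curve D k d) ∞
      fun p : Isom d × Imm D k d => Curve.postcompL (SO.toCLM p.1.rot) :=
    Curve.postcompL.contDiff.contMDiff.comp (Isom.contMDiff_toCLM_rot.comp contMDiff_fst)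
  have h2 : ContMDiff ((Isom.model d).prod 𝓘(ℝ, Curve D k d)) 𝓘(ℝ, Curve D k d) ∞
      fun p : Isom d × Imm D k d => Curve.const D k d p.1.trans :=
    (Curve.const D k d).contDiff.contMDiff.comp (Isom.contMDiff_trans.comp contMDiff_fst)
  exact (h1.clm_apply (contMDiff_curve.comp contMDiff_snd)).add h2

theorem contMDiff_isom_const_smul (g : Isom d) :
    ContMDiff 𝓘(ℝ, Curve D k d) 𝓘(ℝ, Curve D k d) ∞ (fun q : Imm D k d => g • q) := by
  have h : ContMDiff 𝓘(ℝ, Curve D k d) ((Isom.model d).prod 𝓘(ℝ, Curve D k d)) ∞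
      (fun q : Imm D k d => (g, q)) := contMDiff_const.prodMk contMDiff_id
  have := contMDiff_isom_smul.comp h
  exact this

/-- The diffeomorphism of the space of immersions given by a rigid motion. -/
def isomDiffeomorph (D : CurveDomain) (k : ℕ) [NeZero k] (g : Isom d) :
    Diffeomorph 𝓘(ℝ, Curve D k d) 𝓘(ℝ, Curve D k d) (Imm D k d) (Imm D k d) ∞ where
  toEquiv := MulAction.toPerm g
  contMDiff_toFun := contMDiff_isom_const_smul g
  contMDiff_invFun := contMDiff_isom_const_smul g⁻¹

theorem contMDiff_diff_smul (l : ℕ) :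
    ContMDiff (𝓘(ℝ, C0k (k + l) d).prod 𝓘(ℝ, Curve D k d)) 𝓘(ℝ, Curve D k d) l
      fun p : Diff0 (k + l) d × Imm D k d => Diff0.incl k l p.1 • p.2 := by
  refine contMDiff_of_curve ?_
  have hq : ContMDiff (𝓘(ℝ, C0k (k + l) d).prod 𝓘(ℝ, Curve D k d)) 𝓘(ℝ, Curve D k d) l
      fun p : Diff0 (k + l) d × Imm D k d => p.2.curve :=
    (contMDiff_curve.of_le (by exact_mod_cast le_top)).comp contMDiff_snd
  have hu : ContMDiff (𝓘(ℝ, C0k (k + l) d).prod 𝓘(ℝ, Curve D k d)) 𝓘(ℝ, C0k (k + l) d) l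
      fun p : Diff0 (k + l) d × Imm D k d => p.1.disp :=
    (Diff0.contMDiff_disp.of_le (by exact_mod_cast le_top)).comp contMDiff_fst
  exact hq.add ((Curve.contDiff_comp k l (k + l) le_rfl).contMDiff.comp (hu.prodMk_space hq))

theorem continuous_diff_smul : Continuous fun p : Diff0 k d × Imm D k d => p.1 • p.2 :=
  (contMDiff_diff_smul (D := D) (k := k) (d := d) 0).continuous

/-- With `q` fixed the orbit is affine in the displacement, with bounded linear part
`Curve.compCLM`. Hence it is smooth without any loss of derivatives. -/
theorem contMDiff_diff_orbit (q : Imm D k d) :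
    ContMDiff 𝓘(ℝ, C0k k d) 𝓘(ℝ, Curve D k d) ∞ fun φ : Diff0 k d => φ • q := by
  refine contMDiff_of_curve ?_
  exact contMDiff_const.add ((Curve.compCLM q.curve).contDiff.contMDiff.comp Diff0.contMDiff_disp)

/-- The inclusion of immersions into curves has identity differential, so the differential is read
off from the affine expression by uniqueness. -/
theorem hasMFDerivAt_diff_orbit (φ : Diff0 k d) (q : Imm D k d) :
    HasMFDerivAt 𝓘(ℝ, C0k k d) 𝓘(ℝ, Curve D k d) (fun φ : Diff0 k d => φ • q) φ
      (Curve.compCLM q.curve) := by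
  have h1 := ((contMDiff_diff_orbit q).mdifferentiableAt (x := φ) (by simp)).hasMFDerivAt
  have h2 := (hasMFDerivAt_curve (φ • q)).comp φ h1
  have h3 : HasMFDerivAt 𝓘(ℝ, C0k k d) 𝓘(ℝ, Curve D k d)
      (fun φ : Diff0 k d => q.curve + Curve.comp φ.disp q.curve) φ (Curve.compCLM q.curve) := by
    have hf : HasFDerivAt (fun u : C0k k d => q.curve + Curve.comp u q.curve)
        (Curve.compCLM q.curve) φ.disp := (Curve.compCLM q.curve).hasFDerivAt.const_add q.curve
    exact hf.hasMFDerivAt.comp φ (Diff0.hasMFDerivAt_disp φ)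
  have e := hasMFDerivAt_unique h2 h3
  have e' : mfderiv 𝓘(ℝ, C0k k d) 𝓘(ℝ, Curve D k d) (fun φ : Diff0 k d => φ • q) φ
    = Curve.compCLM q.curve := e
  rwa [e'] at h1

/-! ### The action of the semidirect product and its infinitesimal action -/

/-- The action of a rigid motion on both factors of `Isom(ℝ^d) × Imm_{C^k}(D, ℝ^d)`. -/
def rigid (p : Isom d × (Isom d × Imm D k d)) : Isom d × Imm D k d := (p.1 * p.2.1, p.1 • p.2.2)

theorem contMDiff_rigid :
    ContMDiff ((Isom.model d).prod ((Isom.model d).prod 𝓘(ℝ, Curve D k d)))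
      ((Isom.model d).prod 𝓘(ℝ, Curve D k d)) ∞ (rigid (D := D) (k := k) (d := d)) := by
  have h1 : ContMDiff ((Isom.model d).prod ((Isom.model d).prod 𝓘(ℝ, Curve D k d)))
      ((Isom.model d).prod (Isom.model d)) ∞
      fun p : Isom d × (Isom d × Imm D k d) => (p.1, p.2.1) :=
    contMDiff_fst.prodMk (contMDiff_fst.comp contMDiff_snd)
  have h2 : ContMDiff ((Isom.model d).prod ((Isom.model d).prod 𝓘(ℝ, Curve D k d)))
      ((Isom.model d).prod 𝓘(ℝ, Curve D k d)) ∞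
      fun p : Isom d × (Isom d × Imm D k d) => (p.1, p.2.2) :=
    contMDiff_fst.prodMk (contMDiff_snd.comp contMDiff_snd)
  have h3 := Isom.contMDiff_mul.comp h1
  have h4 := contMDiff_isom_smul.comp h2
  exact h3.prodMk h4

/-- The orbit map is `rigid` after `a ↦ (g, (h, φ · q))`, whose middle component is constant and
contributes `0`. The base point keeps `1 • q` unsimplified so as to match the chain rule by
definition. -/
theorem hasMFDerivAt_orbit (p : Isom d × Imm D k d) :
    HasMFDerivAt (IsomDiff.model k d) ((Isom.model d).prod 𝓘(ℝ, Curve D k d))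
      (fun a : IsomDiff k d => a • p) 1
      ((mfderiv ((Isom.model d).prod ((Isom.model d).prod 𝓘(ℝ, Curve D k d)))
        ((Isom.model d).prod 𝓘(ℝ, Curve D k d)) rigid (1, (p.1, (1 : Diff0 k d) • p.2))).comp
        ((ContinuousLinearMap.fst ℝ (Skew d × Euc d) (C0k k d)).prod
          ((0 : IsomDiff.TangentOne k d →L[ℝ] Skew d × Euc d).prod
            ((Curve.compCLM p.2.curve).comp
              (ContinuousLinearMap.snd ℝ (Skew d × Euc d) (C0k k d)))))) := by
  have h1 := ((contMDiff_rigid (D := D) (k := k) (d := d)).mdifferentiableAt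
    (x := (1, (p.1, (1 : Diff0 k d) • p.2))) (by simp)).hasMFDerivAt
  have h2 : HasMFDerivAt (IsomDiff.model k d) 𝓘(ℝ, Curve D k d)
      (fun a : IsomDiff k d => a.diff • p.2) 1 ((Curve.compCLM p.2.curve).comp
        (ContinuousLinearMap.snd ℝ (Skew d × Euc d) (C0k k d))) :=
    (hasMFDerivAt_diff_orbit (1 : IsomDiff k d).diff p.2).comp 1 (IsomDiff.hasMFDerivAt_diff 1)
  have h3 : HasMFDerivAt (IsomDiff.model k d) (Isom.model d)
      (fun _ : IsomDiff k d => p.1) 1 (0 : IsomDiff.TangentOne k d →L[ℝ] Skew d × Euc d) :=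
    hasMFDerivAt_const p.1 1
  exact HasMFDerivAt.comp (g := rigid) (f := fun a : IsomDiff k d => (a.isom, (p.1, a.diff • p.2)))
    1 h1 ((IsomDiff.hasMFDerivAt_isom 1).prodMk (h3.prodMk h2))

theorem continuous_action :
    Continuous fun p : IsomDiff k d × (Isom d × Imm D k d) => p.1 • p.2 := by
  have h1 : Continuous fun p : IsomDiff k d × (Isom d × Imm D k d) => p.1.diff • p.2.2 :=
    continuous_diff_smul.comp ((IsomDiff.contMDiff_diff.continuous.comp continuous_fst).prodMk
      (continuous_snd.comp continuous_snd))
  exact contMDiff_rigid.continuous.comp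
    ((IsomDiff.contMDiff_isom.continuous.comp continuous_fst).prodMk
      ((continuous_fst.comp continuous_snd).prodMk h1))

theorem contMDiff_orbit (p : Isom d × Imm D k d) :
    ContMDiff (IsomDiff.model k d) ((Isom.model d).prod 𝓘(ℝ, Curve D k d)) ∞
      fun a : IsomDiff k d => a • p := by
  have h1 : ContMDiff (IsomDiff.model k d) 𝓘(ℝ, Curve D k d) ∞
      fun a : IsomDiff k d => a.diff • p.2 :=
    (contMDiff_diff_orbit p.2).comp IsomDiff.contMDiff_diff
  have h2 : ContMDiff (IsomDiff.model k d)
      ((Isom.model d).prod ((Isom.model d).prod 𝓘(ℝ, Curve D k d))) ∞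
      fun a : IsomDiff k d => (a.isom, (p.1, a.diff • p.2)) :=
    IsomDiff.contMDiff_isom.prodMk (contMDiff_const.prodMk h1)
  have := contMDiff_rigid.comp h2
  exact this

theorem contMDiff_action (l : ℕ) :
    ContMDiff ((IsomDiff.model (k + l) d).prod ((Isom.model d).prod 𝓘(ℝ, Curve D k d)))
      ((Isom.model d).prod 𝓘(ℝ, Curve D k d)) l
      fun p : IsomDiff (k + l) d × (Isom d × Imm D k d) => IsomDiff.incl k l p.1 • p.2 := by
  have hl : (l : ℕ∞ω) ≤ ∞ := by exact_mod_cast le_top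
  have h0 : ContMDiff ((IsomDiff.model (k + l) d).prod ((Isom.model d).prod 𝓘(ℝ, Curve D k d)))
      (𝓘(ℝ, C0k (k + l) d).prod 𝓘(ℝ, Curve D k d)) l
      fun p : IsomDiff (k + l) d × (Isom d × Imm D k d) => (p.1.diff, p.2.2) :=
    ((IsomDiff.contMDiff_diff.of_le hl).comp contMDiff_fst).prodMk
      (contMDiff_snd.comp contMDiff_snd)
  have h1 : ContMDiff ((IsomDiff.model (k + l) d).prod ((Isom.model d).prod 𝓘(ℝ, Curve D k d)))
      ((Isom.model d).prod ((Isom.model d).prod 𝓘(ℝ, Curve D k d))) l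
      fun p : IsomDiff (k + l) d × (Isom d × Imm D k d) =>
        (p.1.isom, (p.2.1, Diff0.incl k l p.1.diff • p.2.2)) :=
    ((IsomDiff.contMDiff_isom.of_le hl).comp contMDiff_fst).prodMk
      ((contMDiff_fst.comp contMDiff_snd).prodMk ((contMDiff_diff_smul l).comp h0))
  have := (contMDiff_rigid.of_le hl).comp h1
  exact this

/-- The velocity `(X, p) ↦ (X_g, (0, X_u ∘ q))` at the point `(1, (h, q))` of
`Isom(ℝ^d) × (Isom(ℝ^d) × Imm_{C^k}(D, ℝ^d))`. -/
def velocity (l : ℕ) (y : IsomDiff.TangentOne (k + l) d × (Isom d × Imm D k d)) :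
    TangentBundle ((Isom.model d).prod ((Isom.model d).prod 𝓘(ℝ, Curve D k d)))
      (Isom d × (Isom d × Imm D k d)) :=
  ⟨(1, (y.2.1, (1 : Diff0 k d) • y.2.2)),
    ((y.1.1, ((0 : Skew d × Euc d), Curve.comp (C0k.incl k l y.1.2) y.2.2.curve)) :
      (Skew d × Euc d) × ((Skew d × Euc d) × Curve D k d))⟩

theorem contMDiff_velocity (l : ℕ) :
    ContMDiff (𝓘(ℝ, IsomDiff.TangentOne (k + l) d).prod ((Isom.model d).prod 𝓘(ℝ, Curve D k d)))
      ((Isom.model d).prod ((Isom.model d).prod 𝓘(ℝ, Curve D k d))).tangent l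
      (velocity (D := D) (k := k) (d := d) l) := by
  have hl : (l : ℕ∞ω) ≤ ∞ := by exact_mod_cast le_top
  set J := 𝓘(ℝ, IsomDiff.TangentOne (k + l) d).prod ((Isom.model d).prod 𝓘(ℝ, Curve D k d))
  have hX : ContMDiff J 𝓘(ℝ, IsomDiff.TangentOne (k + l) d) l
      fun y : IsomDiff.TangentOne (k + l) d × (Isom d × Imm D k d) => y.1 := contMDiff_fst
  have hg : ContMDiff J (Isom.model d) l
      fun y : IsomDiff.TangentOne (k + l) d × (Isom d × Imm D k d) => y.2.1 :=
    contMDiff_fst.comp contMDiff_snd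
  have hq : ContMDiff J 𝓘(ℝ, Curve D k d) l
      fun y : IsomDiff.TangentOne (k + l) d × (Isom d × Imm D k d) => y.2.2 :=
    contMDiff_snd.comp contMDiff_snd
  have h1 : ContMDiff J (Isom.model d).tangent l
      fun y : IsomDiff.TangentOne (k + l) d × (Isom d × Imm D k d) =>
        (⟨(1 : Isom d), y.1.1⟩ : TangentBundle (Isom.model d) (Isom d)) :=
    (contMDiff_tangentSpace_inclusion (I := Isom.model d) (1 : Isom d)).comp
      ((ContinuousLinearMap.fst ℝ (Skew d × Euc d) (C0k (k + l) d)).contDiff.contMDiff.comp hX)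
  have h2 : ContMDiff J (Isom.model d).tangent l
      fun y : IsomDiff.TangentOne (k + l) d × (Isom d × Imm D k d) =>
        (⟨y.2.1, (0 : Skew d × Euc d)⟩ : TangentBundle (Isom.model d) (Isom d)) :=
    (Bundle.contMDiff_zeroSection ℝ (TangentSpace (Isom.model d) : Isom d → Type _)).comp hg
  have hc := (contMDiff_curve.of_le hl).comp hq
  have hu : ContMDiff J 𝓘(ℝ, C0k (k + l) d) l
      fun y : IsomDiff.TangentOne (k + l) d × (Isom d × Imm D k d) => y.1.2 :=
    (ContinuousLinearMap.snd ℝ (Skew d × Euc d) (C0k (k + l) d)).contDiff.contMDiff.comp hX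
  have h3 : ContMDiff J 𝓘(ℝ, Curve D k d).tangent l
      fun y : IsomDiff.TangentOne (k + l) d × (Isom d × Imm D k d) =>
        (⟨(1 : Diff0 k d) • y.2.2, Curve.comp (C0k.incl k l y.1.2) y.2.2.curve⟩ :
          TangentBundle 𝓘(ℝ, Curve D k d) (Imm D k d)) := by
    refine TopologicalSpace.Opens.contMDiff_tangentBundle_mk (U := immOpens D k d) ?_ ?_
    · simp only [one_smul]
      exact hq
    · exact (Curve.contDiff_comp k l (k + l) le_rfl).contMDiff.comp (hu.prodMk_space hc)
  -- The tangent bundle of a product is the product of the tangent bundles, so the three vectors are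
  -- assembled factor by factor.
  have h23 := (contMDiff_equivTangentBundleProd_symm (n := l) (I := Isom.model d) (M := Isom d)
    (I' := 𝓘(ℝ, Curve D k d)) (M' := Imm D k d)).comp (h2.prodMk h3)
  exact (contMDiff_equivTangentBundleProd_symm (n := l) (I := Isom.model d) (M := Isom d)
    (I' := (Isom.model d).prod 𝓘(ℝ, Curve D k d)) (M' := Isom d × Imm D k d)).comp (h1.prodMk h23)

/-- Expresses the infinitesimal action through the tangent map of the smooth map `rigid`, so that
its regularity follows from that of `velocity` without computing the differential of `rigid`. -/
theorem infinitesimalAction_eq (l : ℕ)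
    (y : IsomDiff.TangentOne (k + l) d × (Isom d × Imm D k d)) :
    (⟨(1 : IsomDiff k d) • y.2, infinitesimalAction k d ((Isom.model d).prod 𝓘(ℝ, Curve D k d)) y.2
      (IsomDiff.tangentIncl k l y.1)⟩ :
      TangentBundle ((Isom.model d).prod 𝓘(ℝ, Curve D k d)) (Isom d × Imm D k d)) =
    tangentMap ((Isom.model d).prod ((Isom.model d).prod 𝓘(ℝ, Curve D k d)))
      ((Isom.model d).prod 𝓘(ℝ, Curve D k d)) rigid (velocity l y) := by
  rw [infinitesimalAction, (hasMFDerivAt_orbit y.2).mfderiv]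
  rfl

theorem contMDiff_infinitesimalAction (l : ℕ) :
    ContMDiff (𝓘(ℝ, IsomDiff.TangentOne (k + l) d).prod ((Isom.model d).prod 𝓘(ℝ, Curve D k d)))
      ((Isom.model d).prod 𝓘(ℝ, Curve D k d)).tangent l
      fun y : IsomDiff.TangentOne (k + l) d × (Isom d × Imm D k d) =>
        (⟨(1 : IsomDiff k d) • y.2,
          infinitesimalAction k d ((Isom.model d).prod 𝓘(ℝ, Curve D k d)) y.2
            (IsomDiff.tangentIncl k l y.1)⟩ :
          TangentBundle ((Isom.model d).prod 𝓘(ℝ, Curve D k d)) (Isom d × Imm D k d)) := by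
  simp only [infinitesimalAction_eq]
  -- Passing to the tangent map costs one order, so `rigid` is used at order `l + 1`.
  have hl : (l : ℕ∞ω) + 1 ≤ ∞ := by exact_mod_cast le_top
  have := (contMDiff_rigid.contMDiff_tangentMap hl).comp (contMDiff_velocity (D := D) (k := k) (d := d) l)
  exact this

theorem isShapeSpace :
    IsShapeSpace k d ((Isom.model d).prod 𝓘(ℝ, Curve D k d)) (Isom d × Imm D k d) where
  continuous_action := continuous_action
  contMDiff_orbit := contMDiff_orbit
  contMDiff_action l _ := contMDiff_action l
  contMDiff_infinitesimalAction l _ := contMDiff_infinitesimalAction l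

end Imm

theorem mainTheorem10 (k d : ℕ) [NeZero k] (D : CurveDomain) :
    -- the action of the rigid motions on immersions is smooth, by diffeomorphisms
    ContMDiff ((Isom.model d).prod 𝓘(ℝ, Curve D k d)) 𝓘(ℝ, Curve D k d) ∞
      (fun p : Isom d × Imm D k d => p.1 • p.2) ∧
    (∀ g : Isom d, ∃ Φ : Diffeomorph 𝓘(ℝ, Curve D k d) 𝓘(ℝ, Curve D k d) (Imm D k d) (Imm D k d) ∞,
      ∀ q, Φ q = g • q) ∧
    -- the compatibility condition
    (∀ (φ : Diff0 k d) (g : Isom d) (q : Imm D k d), φ • (g • q) = g • (Diff0.rho g φ • q)) ∧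
    -- the shape space structure
    IsShapeSpace k d ((Isom.model d).prod 𝓘(ℝ, Curve D k d)) (Isom d × Imm D k d) :=
  ⟨Imm.contMDiff_isom_smul, fun g => ⟨Imm.isomDiffeomorph D k g, fun _ => rfl⟩,
    Imm.diff_smul_isom_smul, Imm.isShapeSpace⟩

end
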